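/- All digraphs are finite, without loops and without multiple arcs (opposite arcs are allowed). A cycle has length at least $2$; $N^+(v),N^-(v)$ are the out- and in-neighbourhoods of $v$; two vertices are adjacent if there is an arc between them in at least one direction. Let $D$ be a strong digraph of order $n=2m+1\ge 3$ that contains a cycle of length $n-1$. Then (up to isomorphism in (ii) and (iii)) at least one of the following holds. (i) $D$ contains a cycle through all vertices with in-degree and out-degree at least $m$. (ii) $D$ is $D_5$ or $D_7$, or belongs to $L_1\cup L_2$. Here $D_5$ has vertices $x_1,x_2,x_3,x,y$ and $N^+(x_1)=\{x_2,y\}$, $N^+(x_2)=\{x_3,x\}$, $N^+(x_3)=\{x,y\}$, $N^+(x)=\{x_1,x_2\}$, $N^+(y)=\{x_1,x_3\}$; $D_7$ has vertices $x_1,\dots,x_5,x,y$ and $N^+(x_1)=\{x_2,x_5,y\}$, $N^+(x_2)=\{x_3,x_4,y\}$, $N^+(x_3)=\{x_2,x_4,x\}$, $N^+(x_4)=\{x_3,x_5,x\}$, $N^+(x_5)=\{x_1,x,y\}$, $N^+(x)=\{x_1,x_2,x_3\}$, $N^+(y)=\{x_1,x_4,x_5\}$; $L_1$ consists of the three digraphs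 obtained from $D_5$ by adding the arc $x_1x_3$, or $x_3x_1$, or both; and $L_2$ consists of the digraphs with vertices $x_1,\dots,x_{2m},x$ such that $x_1x_2\cdots x_{2m}x_1$ is a cycle, $x$ and $x_{2m}$ are not adjacent, $N^+(x)=N^+(x_{2m})=\{x_1,\dots,x_m\}$, $N^-(x)=N^-(x_{2m})=\{x_m,\dots,x_{2m-1}\}$, and there is no arc from $\{x_1,\dots,x_{m-1}\}$ to $\{x_{m+1},\dots,x_{2m-1}\}$. (iii) $K^*_{m,m+1}\subseteq D\subseteq[K_m+\overline K_{m+1}]^*$, as spanning subdigraphs, where $G^*$ is obtained from a graph $G$ by replacing every edge by two opposite arcs, and $+$ is the join of graphs. (iv) $D$ contains a cycle $C=x_1x_2\cdots x_{2m}x_1$ of length $n-1$ (subscripts modulo $2m$) such that, for the vertex $x\notin V(C)$ and the list $x_{l_1},\dots,x_{l_j}$ of all vertices of $C$ not adjacent to $x$, we have $j\ge 2$, and for every $i\in\{1,\dots,j\}$: $x_{l_i-1}x$ and $xx_{l_i+1}$ are arcs of $D$, $N^+(x)=N^+(x_{l_i})$ and $N^-(x)=N^-(x_{l_i})$; in particular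 $\{x_{l_1},\dots,x_{l_j},x\}$ is an independent set (of at least three vertices). -/

import Mathlib

/-! Digraphs are Mathlib's `Digraph V` (an arbitrary relation, so parallel arcs are excluded);
looplessness is the separate predicate `Digraph.Loopless`. -/

namespace Digraph

/-- The digraph has no loops. -/
def Loopless {V : Type*} (D : Digraph V) : Prop :=
  ∀ v, ¬ D.Adj v v

/-- The out-neighbourhood `N⁺(v)`. -/
def outNbhd {V : Type*} (D : Digraph V) (v : V) : Set V :=
  {u | D.Adj v u}

/-- The in-neighbourhood `N⁻(v)`. -/
def inNbhd {V : Type*} (D : Digraph V) (v : V) : Set V :=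
  {u | D.Adj u v}

/-- The out-degree `d⁺(v)`. -/
noncomputable def outDeg {V : Type*} (D : Digraph V) (v : V) : ℕ :=
  (D.outNbhd v).ncard

/-- The in-degree `d⁻(v)`. -/
noncomputable def inDeg {V : Type*} (D : Digraph V) (v : V) : ℕ :=
  (D.inNbhd v).ncard

/-- No arc in either direction joins `u` and `v`. -/
def NonAdjacent {V : Type*} (D : Digraph V) (u v : V) : Prop :=
  ¬ D.Adj u v ∧ ¬ D.Adj v u

/-- No two distinct vertices of `S` are joined by an arc. -/
def IsIndependent {V : Type*} (D : Digraph V) (S : Set V) : Prop :=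
  S.Pairwise D.NonAdjacent

/-- Strong: any two distinct vertices are joined by directed paths in both directions. -/
def IsStrong {V : Type*} (D : Digraph V) : Prop :=
  ∀ x y, x ≠ y → Relation.ReflTransGen D.Adj x y ∧ Relation.ReflTransGen D.Adj y x

/-- `c` lists the vertices of a directed cycle of length `k ≥ 2`, with subscripts modulo `k`. -/
def IsDirCycle {V : Type*} (D : Digraph V) {k : ℕ} (c : ZMod k → V) : Prop :=
  2 ≤ k ∧ Function.Injective c ∧ ∀ i, D.Adj (c i) (c (i + 1))

/-- Isomorphism of digraphs. -/
def IsIsomorphic {V W : Type*} (D : Digraph V) (E : Digraph W) : Prop :=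
  Nonempty (D.Adj ≃r E.Adj)

/-- The symmetric digraph `G^*`: every edge is replaced by two opposite arcs. -/
def ofSimpleGraph {V : Type*} (G : SimpleGraph V) : Digraph V where
  Adj := G.Adj

/-- The digraph obtained by adding a set of arcs. -/
def addArcs {V : Type*} (D : Digraph V) (S : Set (V × V)) : Digraph V where
  Adj u v := D.Adj u v ∨ (u, v) ∈ S

/-- The digraph `D₅`; the vertices `x₁, x₂, x₃, x, y` are `0, 1, 2, 3, 4` in this order,
and the rows list the out-neighbours. -/
def D5 : Digraph (Fin 5) where
  Adj u v := v ∈ (![{1, 4}, {2, 3}, {3, 4}, {0, 1}, {0, 2}] : Fin 5 → Finset (Fin 5)) u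

/-- The digraph `D₇`; the vertices `x₁, x₂, x₃, x₄, x₅, x, y` are `0, 1, 2, 3, 4, 5, 6` in this
order, and the rows list the out-neighbours. -/
def D7 : Digraph (Fin 7) where
  Adj u v := v ∈ (![{1, 4, 6}, {2, 3, 6}, {1, 3, 5}, {2, 4, 5}, {0, 5, 6}, {0, 1, 2}, {0, 3, 4}] :
    Fin 7 → Finset (Fin 7)) u

/-- The three digraphs obtained from `D₅` by adding `x₁x₃`, or `x₃x₁`, or both. -/
def L1 : Set (Digraph (Fin 5)) :=
  {D5.addArcs {(0, 2)}, D5.addArcs {(2, 0)}, D5.addArcs {(0, 2), (2, 0)}}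

/-- Membership in the class `L₂` (for order `2m + 1`), for some labelling
`x₁, …, x_{2m}, x` of the vertices, where `x_i` is `c i`. -/
def MemL2 {V : Type*} (m : ℕ) (D : Digraph V) : Prop :=
  ∃ (c : ZMod (2 * m) → V) (x : V),
    D.IsDirCycle c ∧ x ∉ Set.range c ∧ (∀ v, v = x ∨ v ∈ Set.range c) ∧
    D.NonAdjacent x (c ((2 * m : ℕ) : ZMod (2 * m))) ∧
    D.outNbhd x = {v | ∃ i : ℕ, 1 ≤ i ∧ i ≤ m ∧ v = c (i : ZMod (2 * m))} ∧
    D.outNbhd (c ((2 * m : ℕ) : ZMod (2 * m))) = D.outNbhd x ∧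
    D.inNbhd x = {v | ∃ i : ℕ, m ≤ i ∧ i ≤ 2 * m - 1 ∧ v = c (i : ZMod (2 * m))} ∧
    D.inNbhd (c ((2 * m : ℕ) : ZMod (2 * m))) = D.inNbhd x ∧
    ∀ i j : ℕ, 1 ≤ i → i ≤ m - 1 → m + 1 ≤ j → j ≤ 2 * m - 1 →
      ¬ D.Adj (c (i : ZMod (2 * m))) (c (j : ZMod (2 * m)))

/-- `K^*_{m,m+1}`. -/
def lowerExtremal (m : ℕ) : Digraph (Fin m ⊕ Fin (m + 1)) :=
  ofSimpleGraph (_root_.completeBipartiteGraph (Fin m) (Fin (m + 1)))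

/-- `[K_m + K̄_{m+1}]^*`, where `+` is the join: the disjoint union together with all edges
between the two parts. -/
def upperExtremal (m : ℕ) : Digraph (Fin m ⊕ Fin (m + 1)) :=
  ofSimpleGraph
    (((⊤ : SimpleGraph (Fin m)) ⊕g (⊥ : SimpleGraph (Fin (m + 1)))) ⊔
      _root_.completeBipartiteGraph (Fin m) (Fin (m + 1)))

/-- `D` contains a cycle through all vertices with in-degree and out-degree at least `m`. -/
def HasTCycle {V : Type*} (m : ℕ) (D : Digraph V) : Prop :=
  ∃ (k : ℕ) (c : ZMod k → V), D.IsDirCycle c ∧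
    ∀ v, m ≤ D.inDeg v → m ≤ D.outDeg v → v ∈ Set.range c

/-- Up to isomorphism, `K^*_{m,m+1} ⊆ D ⊆ [K_m + K̄_{m+1}]^*`. -/
def IsBetween {V : Type*} (m : ℕ) (D : Digraph V) : Prop :=
  ∃ E : Digraph (Fin m ⊕ Fin (m + 1)),
    D.IsIsomorphic E ∧ lowerExtremal m ≤ E ∧ E ≤ upperExtremal m

/-- There are a cycle `c` of length `2m` and a vertex `x` off it such that at least two vertices of
`c` are not adjacent to `x`, every such vertex has the same out- and in-neighbours as `x` and its
predecessor and successor on `c` dominate and are dominated by `x`, respectively; these vertices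
and `x` form an independent set. -/
def HasTwinStructure {V : Type*} (m : ℕ) (D : Digraph V) : Prop :=
  ∃ (c : ZMod (2 * m) → V) (x : V),
    D.IsDirCycle c ∧ x ∉ Set.range c ∧
    2 ≤ {i | D.NonAdjacent x (c i)}.ncard ∧
    (∀ i, D.NonAdjacent x (c i) →
      D.Adj (c (i - 1)) x ∧ D.Adj x (c (i + 1)) ∧
      D.outNbhd x = D.outNbhd (c i) ∧ D.inNbhd x = D.inNbhd (c i)) ∧
    D.IsIndependent (insert x {v | ∃ i, v = c i ∧ D.NonAdjacent x (c i)})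

end Digraph

/-! Suppose that no cycle contains all vertices of in-degree and out-degree at least `m`. Then there
is no Hamiltonian cycle, and a vertex `w` missed by a cycle of length `2m` has both semidegrees at
least `m` (`Tight`). On such a cycle, arcs `c i → w` and `w → c (i + 1)` cannot both exist, or `w`
could be inserted. There are only `2m` indices, so exactly one of the two arcs is present for each
`i`, and both semidegrees equal `m` (`Tight.cycle_rule`). This rule drives everything else.

Call a vertex not adjacent to the missed vertex `x` a gap. By the rule a gap `f` can be exchanged
with `x`, which gives a cycle missing `f`, so the rule holds at `f` too. Two gaps either are
non-adjacent, and then have the same neighbourhoods as `x` (`TwoGap.twins`), or are joined in both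
directions (`TwoGap.adj_symm`). A vertex is bad if some arc joins two of its gaps.

If a bad vertex exists, its gaps are pairwise joined in both directions (`Bad.complete`). Take a bad
`x` with the most gaps. If some arc at `x` were one-way, either an exchange would produce a bad
vertex with more gaps, or a Hamiltonian cycle would appear (`Bad.symm_of_max`). Hence gaps and
neighbours of `x` alternate on the cycle. Orders five and seven leave `D5`, `L1` and `D7`; from
order nine on there is a Hamiltonian cycle (`Bad.exceptional`).

If there is no bad vertex, every gap is a twin of `x` (`twins_of_no_bad`). Two or more gaps give the
twin structure (iv); a single gap fixes all arcs at `x` and gives `L₂` (`memL2_of_unique_gap`).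
Alternative (iii) never has to be invoked. -/

namespace Digraph

/-! ### Directed walks as lists -/

/-- `l` lists the vertices of a directed walk from `u` to `v`. -/
def Seg {V : Type*} (D : Digraph V) (u : V) (l : List V) (v : V) : Prop :=
  l.IsChain D.Adj ∧ l.head? = some u ∧ l.getLast? = some v

section Seg

variable {V : Type*} {D : Digraph V} {u v w t : V} {l l' : List V}

theorem Seg.head_mem (h : D.Seg u l v) : u ∈ l := List.mem_of_mem_head? h.2.1

theorem seg_singleton (u : V) : D.Seg u [u] u := ⟨by simp, by simp, by simp⟩

theorem Seg.append (h : D.Seg u l v) (hvw : D.Adj v w) (h' : D.Seg w l' t) :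
    D.Seg u (l ++ l') t := by
  refine ⟨h.1.append h'.1 ?_, ?_, ?_⟩
  · intro a ha b hb
    rw [h.2.2] at ha
    rw [h'.2.1] at hb
    cases ha
    cases hb
    exact hvw
  · simp [List.head?_append, h.2.1]
  · simp [List.getLast?_append, h'.2.2]

theorem Seg.cons (huw : D.Adj u w) (h : D.Seg w l t) : D.Seg u (u :: l) t :=
  (seg_singleton u).append huw h

theorem Seg.concat (h : D.Seg u l v) (hvw : D.Adj v w) : D.Seg u (l ++ [w]) w :=
  h.append hvw (seg_singleton w)

theorem exists_seg (h : l.IsChain D.Adj) (hl : l ≠ []) : ∃ u v, D.Seg u l v :=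
  ⟨l.head hl, l.getLast hl, h, List.head?_eq_some_head hl, List.getLast?_eq_some_getLast hl⟩

theorem Seg.split (h : D.Seg u (l ++ l') v) (hl : l ≠ []) (hl' : l' ≠ []) :
    ∃ a b, D.Seg u l a ∧ D.Adj a b ∧ D.Seg b l' v := by
  obtain ⟨h1, h2, h3⟩ := List.isChain_append.1 h.1
  obtain ⟨u', a, hs⟩ := exists_seg h1 hl
  obtain ⟨b, v', hs'⟩ := exists_seg h2 hl'
  have hu : u' = u := by
    have := h.2.1
    rw [List.head?_append, hs.2.1] at this
    simpa using this
  have hv : v' = v := by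
    have := h.2.2
    rw [List.getLast?_append, hs'.2.2] at this
    simpa using this
  subst hu hv
  exact ⟨a, b, hs, h3 a hs.2.2 b hs'.2.1, hs'⟩

theorem Seg.head_eq (h : D.Seg u (w :: l) v) : w = u := by simpa using h.2.1

theorem Seg.last_eq (h : D.Seg u (l ++ [w]) v) : w = v := by simpa using h.2.2

theorem Seg.cons_cases (h : D.Seg u (u :: l) v) (hl : l ≠ []) :
    ∃ w, D.Adj u w ∧ D.Seg w l v := by
  obtain ⟨a, b, h1, h2, h3⟩ := Seg.split (l := [u]) h (by simp) hl
  have : u = a := by simpa using h1.2.2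
  subst this
  exact ⟨b, h2, h3⟩

end Seg

/-! ### Passing between lists and cyclic sequences -/

section Conversion

variable {V : Type*} {D : Digraph V}

theorem Seg.exists_isDirCycle {u v : V} {l : List V} {k : ℕ} (h : D.Seg u l v) (hvu : D.Adj v u)
    (hl : l.Nodup) (hk : l.length = k) (hk2 : 2 ≤ k) :
    ∃ c : ZMod k → V, D.IsDirCycle c ∧ (∀ a, a ∈ Set.range c ↔ a ∈ l) ∧ c 0 = u ∧ c (-1) = v := by
  obtain ⟨n, rfl⟩ : ∃ n, k = n + 1 := ⟨k - 1, by omega⟩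
  have h0 : l[0] = u := by
    have := h.2.1
    rw [List.head?_eq_getElem?, List.getElem?_eq_getElem (by omega)] at this
    simpa using this
  have hn : l[n] = v := by
    have := h.2.2
    rw [List.getLast?_eq_getElem?, List.getElem?_eq_getElem (by omega)] at this
    simpa [hk] using this
  have hv : ∀ i : ZMod (n + 1), i.val < l.length := fun i =>
    lt_of_lt_of_eq (ZMod.val_lt i) hk.symm
  have hlast : (-1 : ZMod (n + 1)).val = n := ZMod.val_neg_one n
  refine ⟨fun i => l[i.val]'(hv i), ⟨hk2, ?_, ?_⟩, ?_, ?_, ?_⟩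
  · intro i j hij
    exact ZMod.val_injective _ ((List.Nodup.getElem_inj_iff hl).1 hij)
  · intro i
    have hi := ZMod.val_lt i
    have h1 : (i + 1).val = (i.val + 1) % (n + 1) := by
      rw [← ZMod.val_natCast, Nat.cast_add, ZMod.natCast_zmod_val, Nat.cast_one]
    rcases Nat.lt_or_ge i.val n with hj | hj
    · have h2 : (i + 1).val = i.val + 1 := by rw [h1, Nat.mod_eq_of_lt (by omega)]
      simp only [h2]
      exact List.isChain_iff_getElem.1 h.1 i.val (by omega)
    · have h2 : i.val = n := by omega
      have h3 : (i + 1).val = 0 := by rw [h1, h2, Nat.mod_self]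
      simp only [h2, h3, h0, hn]
      exact hvu
  · intro a
    constructor
    · rintro ⟨i, rfl⟩
      exact List.getElem_mem _
    · intro ha
      obtain ⟨i, hi, rfl⟩ := List.mem_iff_getElem.1 ha
      refine ⟨(i : ZMod (n + 1)), ?_⟩
      have : ((i : ℕ) : ZMod (n + 1)).val = i := by
        rw [ZMod.val_natCast, Nat.mod_eq_of_lt (by omega)]
      simp only [this]
  · simp only [ZMod.val_zero, h0]
  · simp only [hlast, hn]

/-- The stretch `c a, c (a + 1), …, c (a + n - 1)` of a cyclic sequence. -/
def arc {k : ℕ} (c : ZMod k → V) (a : ZMod k) (n : ℕ) : List V :=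
  (List.range n).map fun t : ℕ => c (a + t)

theorem length_arc {k : ℕ} (c : ZMod k → V) (a : ZMod k) (n : ℕ) : (arc c a n).length = n := by
  simp [arc]

theorem arc_add {k : ℕ} (c : ZMod k → V) (a : ZMod k) (n r : ℕ) :
    arc c a (n + r) = arc c a n ++ arc c (a + n) r := by
  simp [arc, List.range_add, add_assoc, Function.comp_def]

theorem arc_one {k : ℕ} (c : ZMod k → V) (a : ZMod k) : arc c a 1 = [c a] := by
  simp [arc]

theorem IsDirCycle.seg_arc {k : ℕ} {c : ZMod k → V} (hc : D.IsDirCycle c) (a : ZMod k) (n : ℕ) :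
    D.Seg (c a) (arc c a (n + 1)) (c (a + n)) := by
  induction n with
  | zero => simpa [arc_one] using seg_singleton (D := D) (c a)
  | succ n ih =>
    rw [arc_add, arc_one]
    have h := hc.2.2 (a + n)
    have e : a + ((n + 1 : ℕ) : ZMod k) = a + n + 1 := by push_cast; ring
    rw [e]
    exact ih.concat (by simpa using h)

theorem IsDirCycle.nodup_arc {k : ℕ} {c : ZMod k → V} (hc : D.IsDirCycle c) (a : ZMod k) {n : ℕ}
    (hn : n ≤ k) : (arc c a n).Nodup := by
  rw [arc, List.nodup_map_iff_inj_on List.nodup_range]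
  intro x hx y hy hxy
  have h := add_left_cancel (hc.2.1 hxy)
  rw [ZMod.natCast_eq_natCast_iff'] at h
  rw [List.mem_range] at hx hy
  rwa [Nat.mod_eq_of_lt (by omega), Nat.mod_eq_of_lt (by omega)] at h

theorem mem_arc_of_mem_range {k : ℕ} [NeZero k] (c : ZMod k → V) (a : ZMod k) (v : V) :
    v ∈ arc c a k ↔ v ∈ Set.range c := by
  simp only [arc, List.mem_map, List.mem_range, Set.mem_range]
  constructor
  · rintro ⟨t, -, rfl⟩
    exact ⟨_, rfl⟩
  · rintro ⟨i, rfl⟩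
    exact ⟨(i - a).val, ZMod.val_lt _, by simp⟩

/-- A cyclic sequence, read from `c (i + 1)` around to `c i`. -/
theorem IsDirCycle.seg_full {k : ℕ} {c : ZMod k → V} (hc : D.IsDirCycle c) (i : ZMod k) :
    D.Seg (c (i + 1)) (arc c (i + 1) k) (c i) := by
  obtain ⟨n, rfl⟩ : ∃ n, k = n + 1 := ⟨k - 1, by have := hc.1; omega⟩
  have h := hc.seg_arc (i + 1) n
  have e : i + 1 + (n : ZMod (n + 1)) = i := by
    have : ((n + 1 : ℕ) : ZMod (n + 1)) = 0 := ZMod.natCast_self _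
    push_cast at this
    rw [add_assoc, add_comm 1, this, add_zero]
  rwa [e] at h

end Conversion

/-! ### The counting rule for a cycle that misses one vertex -/

section Tight

variable {V : Type*} {D : Digraph V} {m : ℕ}

/-- `D` is not Hamiltonian, and a vertex missed by a cycle of length `n - 1 = 2m` has both
semidegrees at least `m`. -/
structure Tight (D : Digraph V) (m : ℕ) : Prop where
  pos : 1 ≤ m
  card : Nat.card V = 2 * m + 1
  loopless : D.Loopless
  no_ham : ∀ c : ZMod (2 * m + 1) → V, ¬ D.IsDirCycle c
  deg : ∀ c : ZMod (2 * m) → V, D.IsDirCycle c → ∀ w, w ∉ Set.range c →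
    m ≤ D.inDeg w ∧ m ≤ D.outDeg w

theorem Tight.not_ham (T : D.Tight m) {L : List V} (hL : L.Nodup) (hlen : L.length = 2 * m + 1)
    {u v : V} {l : List V} (h : D.Seg u l v) (hvu : D.Adj v u) (hp : l.Perm L) : False := by
  obtain ⟨c, hc, -⟩ := h.exists_isDirCycle hvu (hp.nodup_iff.2 hL) (hp.length_eq.trans hlen)
    (by have := T.pos; omega)
  exact T.no_ham c hc

/-- The index sets of in-arcs and of shifted out-arcs of `w` are disjoint, since a common index
would let `w` be inserted into the cycle. Each has at least `m` of the `2m` indices, so they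
partition `ZMod (2 * m)` into two sets of size `m`. -/
theorem Tight.cycle_rule [Finite V] (T : D.Tight m) {c : ZMod (2 * m) → V} (hc : D.IsDirCycle c)
    {w : V} (hw : w ∉ Set.range c) :
    (∀ i, D.Adj w (c (i + 1)) ↔ ¬ D.Adj (c i) w) ∧ D.inDeg w = m ∧ D.outDeg w = m := by
  classical
  have hm := T.pos
  have : NeZero (2 * m) := ⟨by omega⟩
  have hnb : ∀ i, ¬ (D.Adj (c i) w ∧ D.Adj w (c (i + 1))) := by
    rintro i ⟨h1, h2⟩
    refine T.not_ham (L := arc c (i + 1) (2 * m) ++ [w]) ?_ ?_ ((hc.seg_full i).concat h1) h2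
      (List.Perm.refl _)
    · rw [List.nodup_append]
      refine ⟨hc.nodup_arc _ le_rfl, by simp, ?_⟩
      intro a ha b hb
      rw [List.mem_singleton] at hb
      subst hb
      rintro rfl
      exact hw ((mem_arc_of_mem_range c (i + 1) a).1 ha)
    · simp [length_arc]
  have hall : ∀ v, v ≠ w → v ∈ Set.range c := by
    have h1 : (Set.range c).ncard = 2 * m := by
      rw [← Set.image_univ, Set.ncard_image_of_injective _ hc.2.1, Set.ncard_univ, Nat.card_zmod]
    have h2 : insert w (Set.range c) = Set.univ := by
      rw [Set.eq_univ_iff_ncard, Set.ncard_insert_of_notMem hw, h1, T.card]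
    intro v hv
    have : v ∈ insert w (Set.range c) := h2 ▸ Set.mem_univ v
    exact this.resolve_left hv
  have hin : D.inNbhd w = c '' {i | D.Adj (c i) w} := by
    ext v
    constructor
    · intro hv
      obtain ⟨i, rfl⟩ := hall v (by rintro rfl; exact T.loopless _ hv)
      exact ⟨i, hv, rfl⟩
    · rintro ⟨i, hi, rfl⟩
      exact hi
  have hinj : Function.Injective fun i => c (i + 1) := fun i j hij =>
    add_right_cancel (hc.2.1 hij)
  have hout : D.outNbhd w = (fun i => c (i + 1)) '' {i | D.Adj w (c (i + 1))} := by
    ext v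
    constructor
    · intro hv
      obtain ⟨i, rfl⟩ := hall v (by rintro rfl; exact T.loopless _ hv)
      exact ⟨i - 1, by simpa [outNbhd] using hv, by simp⟩
    · rintro ⟨i, hi, rfl⟩
      exact hi
  have hind : D.inDeg w = {i | D.Adj (c i) w}.ncard := by
    rw [inDeg, hin, Set.ncard_image_of_injective _ hc.2.1]
  have houtd : D.outDeg w = {i | D.Adj w (c (i + 1))}.ncard := by
    rw [outDeg, hout, Set.ncard_image_of_injective _ hinj]
  obtain ⟨hd1, hd2⟩ := T.deg c hc w hw
  have hdisj : Disjoint {i | D.Adj (c i) w} {i | D.Adj w (c (i + 1))} :=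
    Set.disjoint_left.2 fun i h1 h2 => hnb i ⟨h1, h2⟩
  have hun := Set.ncard_union_eq hdisj
  have hle : ({i | D.Adj (c i) w} ∪ {i | D.Adj w (c (i + 1))}).ncard ≤ 2 * m := by
    have := Set.ncard_le_card ({i | D.Adj (c i) w} ∪ {i | D.Adj w (c (i + 1))})
    rwa [Nat.card_zmod] at this
  have huniv : ({i | D.Adj (c i) w} ∪ {i | D.Adj w (c (i + 1))}) = Set.univ := by
    rw [Set.eq_univ_iff_ncard, Nat.card_zmod]
    omega
  refine ⟨fun i => ⟨fun h1 h2 => hnb i ⟨h2, h1⟩, fun h => ?_⟩, by omega, by omega⟩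
  have : i ∈ ({i | D.Adj (c i) w} ∪ {i | D.Adj w (c (i + 1))}) := huniv ▸ Set.mem_univ i
  exact this.resolve_left h

/-- For consecutive vertices `v`, `u` of a cycle that misses exactly `w`, exactly one of the arcs
`wu`, `vw` is present. -/
theorem Tight.rule [Finite V] (T : D.Tight m) {L : List V} (hL : L.Nodup)
    (hlen : L.length = 2 * m + 1) (w : V) {u v : V} {l : List V} (h : D.Seg u l v)
    (hvu : D.Adj v u) (hp : (w :: l).Perm L) : D.Adj w u ↔ ¬ D.Adj v w := by
  have hn := hp.nodup_iff.2 hL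
  have hl := hp.length_eq.trans hlen
  rw [List.length_cons] at hl
  obtain ⟨c, hc, hr, h0, h1⟩ := h.exists_isDirCycle (k := 2 * m) hvu (List.nodup_cons.1 hn).2
    (by omega) (by have := T.pos; omega)
  have := (T.cycle_rule hc (w := w) (by rw [hr]; exact (List.nodup_cons.1 hn).1)).1 (-1)
  rwa [neg_add_cancel, h0, h1] at this

theorem Tight.deg_eq [Finite V] (T : D.Tight m) {L : List V} (hL : L.Nodup)
    (hlen : L.length = 2 * m + 1) (w : V) {u v : V} {l : List V} (h : D.Seg u l v)
    (hvu : D.Adj v u) (hp : (w :: l).Perm L) : D.inDeg w = m ∧ D.outDeg w = m := by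
  have hn := hp.nodup_iff.2 hL
  have hl := hp.length_eq.trans hlen
  rw [List.length_cons] at hl
  obtain ⟨c, hc, hr, h0, h1⟩ := h.exists_isDirCycle (k := 2 * m) hvu (List.nodup_cons.1 hn).2
    (by omega) (by have := T.pos; omega)
  exact (T.cycle_rule hc (w := w) (by rw [hr]; exact (List.nodup_cons.1 hn).1)).2

end Tight

section Split

variable {V : Type*} {D : Digraph V} {u v w : V} {l : List V}

theorem Seg.exists_next (h : D.Seg u l v) (hw : w ∈ l) :
    w = v ∨ ∃ l₁ l₂ w', l = l₁ ++ l₂ ∧ D.Seg u l₁ w ∧ D.Adj w w' ∧ D.Seg w' l₂ v := by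
  obtain ⟨s, t, rfl⟩ := List.append_of_mem hw
  rcases eq_or_ne t [] with rfl | ht
  · exact Or.inl h.last_eq
  · right
    have e : s ++ w :: t = (s ++ [w]) ++ t := by simp
    rw [e] at h
    obtain ⟨a, b, h1, h2, h3⟩ := h.split (by simp) ht
    have := h1.last_eq
    subst this
    exact ⟨_, _, b, e, h1, h2, h3⟩

theorem Seg.exists_prev (h : D.Seg u l v) (hw : w ∈ l) :
    w = u ∨ ∃ l₁ l₂ w', l = l₁ ++ l₂ ∧ D.Seg u l₁ w' ∧ D.Adj w' w ∧ D.Seg w l₂ v := by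
  obtain ⟨s, t, rfl⟩ := List.append_of_mem hw
  rcases eq_or_ne s [] with rfl | ht
  · exact Or.inl h.head_eq
  · right
    obtain ⟨a, b, h1, h2, h3⟩ := h.split ht (by simp)
    have := h3.head_eq
    subst this
    exact ⟨_, _, a, rfl, h1, h2, h3⟩

end Split

/-! ### Two gaps of the omitted vertex -/

/-- A cycle `y P z Q y` that misses only `x`, where `x` is adjacent to neither `y` nor `z`; the
paths `P` and `Q` lead from `p` to `p'` and from `q` to `q'`. -/
structure TwoGap {V : Type*} (D : Digraph V) (m : ℕ) (x y : V) (P : List V) (z : V) (Q : List V)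
    (p p' q q' : V) : Prop where
  nodup : (x :: y :: (P ++ z :: Q)).Nodup
  length : (x :: y :: (P ++ z :: Q)).length = 2 * m + 1
  segP : D.Seg p P p'
  segQ : D.Seg q Q q'
  yp : D.Adj y p
  pz : D.Adj p' z
  zq : D.Adj z q
  qy : D.Adj q' y
  nxy : D.NonAdjacent x y
  nxz : D.NonAdjacent x z

namespace TwoGap

variable {V : Type*} {D : Digraph V} {m : ℕ} {x y z p p' q q' : V} {P Q : List V}

theorem perm_swap (x y z : V) (P Q : List V) :
    (x :: z :: (Q ++ y :: P)).Perm (x :: y :: (P ++ z :: Q)) := by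
  classical
  exact List.perm_iff_count.2 fun a => by
    simp only [List.count_append, List.count_cons]; ring

theorem swap (h : D.TwoGap m x y P z Q p p' q q') : D.TwoGap m x z Q y P q q' p p' :=
  ⟨(perm_swap x y z P Q).nodup_iff.2 h.nodup, (perm_swap x y z P Q).length_eq.trans h.length,
    h.segQ, h.segP, h.zq, h.qy, h.yp, h.pz, h.nxz, h.nxy⟩

variable [Finite V]

theorem xp (h : D.TwoGap m x y P z Q p p' q q') (T : D.Tight m) : D.Adj x p := by
  classical
  exact (T.rule h.nodup h.length x ((h.segP.append h.pz (h.segQ.cons h.zq)).concat h.qy) h.yp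
    (List.perm_iff_count.2 fun a => by
      simp only [List.count_append, List.count_cons, List.count_nil]; ring)).2 h.nxy.2

theorem qx (h : D.TwoGap m x y P z Q p p' q q') (T : D.Tight m) : D.Adj q' x := by
  classical
  have := T.rule h.nodup h.length x ((h.segP.append h.pz (h.segQ.cons h.zq)).cons h.yp) h.qy
    (List.Perm.refl _)
  by_contra hn
  exact h.nxy.1 (this.2 hn)

theorem xq (h : D.TwoGap m x y P z Q p p' q q') (T : D.Tight m) : D.Adj x q := h.swap.xp T

theorem px (h : D.TwoGap m x y P z Q p p' q q') (T : D.Tight m) : D.Adj p' x := h.swap.qx T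

variable {u w : V} {l₁ l₂ : List V}

theorem rule_x (h : D.TwoGap m x y P z Q p p' q q') (T : D.Tight m) (hP : P = l₁ ++ l₂)
    (h1 : D.Seg p l₁ u) (huw : D.Adj u w) (h2 : D.Seg w l₂ p') : D.Adj x w ↔ ¬ D.Adj u x := by
  classical
  subst hP
  exact T.rule h.nodup h.length x
    ((h2.append h.pz (h.segQ.cons h.zq)).append h.qy (h1.cons h.yp)) huw
    (List.perm_iff_count.2 fun a => by
      simp only [List.count_append, List.count_cons]; ring)

/-- Since `q' → x → p`, the vertex `x` can take the place of `y` on the cycle; the rule is then read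
off the cycle that misses `y`. -/
theorem rule_y (h : D.TwoGap m x y P z Q p p' q q') (T : D.Tight m) (hP : P = l₁ ++ l₂)
    (h1 : D.Seg p l₁ u) (huw : D.Adj u w) (h2 : D.Seg w l₂ p') : D.Adj y w ↔ ¬ D.Adj u y := by
  classical
  subst hP
  exact T.rule h.nodup h.length y
    ((h2.append h.pz (h.segQ.cons h.zq)).append (h.qx T) (h1.cons (h.xp T))) huw
    (List.perm_iff_count.2 fun a => by
      simp only [List.count_append, List.count_cons]; ring)

theorem rule_z (h : D.TwoGap m x y P z Q p p' q q') (T : D.Tight m) (hP : P = l₁ ++ l₂)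
    (h1 : D.Seg p l₁ u) (huw : D.Adj u w) (h2 : D.Seg w l₂ p') : D.Adj z w ↔ ¬ D.Adj u z := by
  classical
  subst hP
  exact T.rule h.nodup h.length z
    ((h2.append (h.px T) (h.segQ.cons (h.xq T))).append h.qy (h1.cons h.yp)) huw
    (List.perm_iff_count.2 fun a => by
      simp only [List.count_append, List.count_cons]; ring)

/-- Otherwise `y → w` by the rule at `y`, and `y w … p' x p … u z q … q' y` is a Hamiltonian cycle.
-/
theorem adj_y_of_adj_z (h : D.TwoGap m x y P z Q p p' q q') (T : D.Tight m) (hP : P = l₁ ++ l₂)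
    (h1 : D.Seg p l₁ u) (huw : D.Adj u w) (h2 : D.Seg w l₂ p') (huz : D.Adj u z) :
    D.Adj u y := by
  classical
  by_contra hn
  have hyw := (h.rule_y T hP h1 huw h2).2 hn
  subst hP
  exact T.not_ham h.nodup h.length
    (((h2.cons hyw).append (h.px T) (h1.cons (h.xp T))).append huz (h.segQ.cons h.zq)) h.qy
    (List.perm_iff_count.2 fun a => by
      simp only [List.count_append, List.count_cons]; ring)

theorem z_adj_of_y_adj (h : D.TwoGap m x y P z Q p p' q q') (T : D.Tight m) (hP : P = l₁ ++ l₂)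
    (h1 : D.Seg p l₁ u) (huw : D.Adj u w) (h2 : D.Seg w l₂ p') (hyw : D.Adj y w) :
    D.Adj z w := by
  rw [h.rule_z T hP h1 huw h2]
  intro huz
  exact (h.rule_y T hP h1 huw h2).1 hyw (h.adj_y_of_adj_z T hP h1 huw h2 huz)

theorem mem_cases (h : D.TwoGap m x y P z Q p p' q q') (T : D.Tight m) (v : V) :
    v = x ∨ v = y ∨ v = z ∨ v ∈ P ∨ v ∈ Q := by
  classical
  have := Fintype.ofFinite V
  have h1 : (x :: y :: (P ++ z :: Q)).toFinset = Finset.univ := by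
    rw [← Finset.card_eq_iff_eq_univ, List.toFinset_card_of_nodup h.nodup, h.length,
      ← Nat.card_eq_fintype_card, T.card]
  have h2 : v ∈ (x :: y :: (P ++ z :: Q)).toFinset := h1 ▸ Finset.mem_univ v
  simp only [List.mem_toFinset, List.mem_cons, List.mem_append] at h2
  tauto

theorem deg_x (h : D.TwoGap m x y P z Q p p' q q') (T : D.Tight m) :
    D.inDeg x = m ∧ D.outDeg x = m :=
  T.deg_eq h.nodup h.length x ((h.segP.append h.pz (h.segQ.cons h.zq)).cons h.yp) h.qy
    (List.Perm.refl _)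

theorem deg_y (h : D.TwoGap m x y P z Q p p' q q') (T : D.Tight m) :
    D.inDeg y = m ∧ D.outDeg y = m :=
  T.deg_eq h.nodup h.length y ((h.segP.append h.pz (h.segQ.cons h.zq)).cons (h.xp T)) (h.qx T)
    (List.Perm.swap _ _ _)

theorem deg_z (h : D.TwoGap m x y P z Q p p' q q') (T : D.Tight m) :
    D.inDeg z = m ∧ D.outDeg z = m := h.swap.deg_y T

theorem twins (h : D.TwoGap m x y P z Q p p' q q') (T : D.Tight m) (hyz : D.NonAdjacent y z) :
    D.outNbhd x = D.outNbhd y ∧ D.inNbhd x = D.inNbhd y := by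
  classical
  have hzy : D.NonAdjacent z y := ⟨hyz.2, hyz.1⟩
  have hxp := h.xp T
  have hxq := h.xq T
  have hpx := h.px T
  have hqx := h.qx T
  have hy : D.TwoGap m y x P z Q p p' q q' :=
    ⟨(List.Perm.swap _ _ _).nodup_iff.2 h.nodup, (List.Perm.swap _ _ _).length_eq.trans h.length,
      h.segP, h.segQ, hxp, h.pz, h.zq, hqx, ⟨h.nxy.2, h.nxy.1⟩, hyz⟩
  have hpy := hy.px T
  have hyq := hy.xq T
  have hperm1 : (z :: x :: (P ++ y :: Q)).Perm (x :: y :: (P ++ z :: Q)) :=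
    List.perm_iff_count.2 fun a => by
      simp only [List.count_append, List.count_cons]; ring
  have hperm2 : (z :: x :: (Q ++ y :: P)).Perm (x :: y :: (P ++ z :: Q)) :=
    List.perm_iff_count.2 fun a => by
      simp only [List.count_append, List.count_cons]; ring
  -- The three vertices `x`, `y`, `z` are pairwise non-adjacent, so each can play the omitted one.
  -- With `z` omitted, the transfer lemmas compare `x` with `y`; equality follows from one inclusion
  -- because all semidegrees are `m`.
  have hz1 : D.TwoGap m z x P y Q p p' q q' :=
    ⟨hperm1.nodup_iff.2 h.nodup, hperm1.length_eq.trans h.length,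
      h.segP, h.segQ, hxp, hpy, hyq, hqx, ⟨h.nxz.2, h.nxz.1⟩, hzy⟩
  have hz2 : D.TwoGap m z x Q y P q q' p p' :=
    ⟨hperm2.nodup_iff.2 h.nodup, hperm2.length_eq.trans h.length,
      h.segQ, h.segP, hxq, h.qy, h.yp, hpx, ⟨h.nxz.2, h.nxz.1⟩, hzy⟩
  have hdx := h.deg_x T
  have hdy := h.deg_y T
  constructor
  · refine Set.eq_of_subset_of_ncard_le ?_ (le_of_eq (hdy.2.trans hdx.2.symm)) (Set.toFinite _)
    intro v hv
    change D.Adj x v at hv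
    change D.Adj y v
    rcases h.mem_cases T v with rfl | rfl | rfl | hvP | hvQ
    · exact absurd hv (T.loopless _)
    · exact absurd hv h.nxy.1
    · exact absurd hv h.nxz.1
    · rcases h.segP.exists_prev hvP with rfl | ⟨l₁, l₂, u, e, h1, h2, h3⟩
      · exact h.yp
      · exact hz1.z_adj_of_y_adj T e h1 h2 h3 hv
    · rcases h.segQ.exists_prev hvQ with rfl | ⟨l₁, l₂, u, e, h1, h2, h3⟩
      · exact hyq
      · exact hz2.z_adj_of_y_adj T e h1 h2 h3 hv
  · refine (Set.eq_of_subset_of_ncard_le ?_ (le_of_eq (hdx.1.trans hdy.1.symm))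
      (Set.toFinite _)).symm
    intro v hv
    change D.Adj v y at hv
    change D.Adj v x
    rcases h.mem_cases T v with rfl | rfl | rfl | hvP | hvQ
    · exact absurd hv h.nxy.1
    · exact absurd hv (T.loopless _)
    · exact absurd hv hyz.2
    · rcases h.segP.exists_next hvP with rfl | ⟨l₁, l₂, u, e, h1, h2, h3⟩
      · exact hpx
      · exact hz1.adj_y_of_adj_z T e h1 h2 h3 hv
    · rcases h.segQ.exists_next hvQ with rfl | ⟨l₁, l₂, u, e, h1, h2, h3⟩
      · exact hqx
      · exact hz2.adj_y_of_adj_z T e h1 h2 h3 hv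

/-- If `z → y` is missing, the rule gives `y → q` and `q' → z`. The out-neighbourhoods of `y` and
`z` have the same size but differ at `z`, so some `v` is dominated by `z` and not by `y`. On `P`,
with predecessor `u`, it yields the Hamiltonian cycle `x p … u y q … q' z v … p' x`; on `Q` it
contradicts `z_adj_of_y_adj`. -/
theorem adj_symm (h : D.TwoGap m x y P z Q p p' q q') (T : D.Tight m) (hyz : D.Adj y z) :
    D.Adj z y := by
  classical
  by_contra hzy
  have hzdeg := h.deg_z T
  have hydeg := h.deg_y T
  obtain ⟨v, hv, hvy⟩ : ∃ v, D.Adj z v ∧ ¬ D.Adj y v := by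
    by_contra hcon
    push Not at hcon
    have : D.outNbhd z = D.outNbhd y :=
      Set.eq_of_subset_of_ncard_le (fun v hv => hcon v hv)
        (le_of_eq (hydeg.2.trans hzdeg.2.symm)) (Set.toFinite _)
    have hz : z ∈ D.outNbhd z := this ▸ hyz
    exact T.loopless z hz
  have hyq : D.Adj y q :=
    (T.rule h.nodup h.length y (((h.segQ.append (h.qx T) (h.segP.cons (h.xp T)))).concat h.pz) h.zq
      (List.perm_iff_count.2 fun a => by
        simp only [List.count_append, List.count_cons, List.count_nil]; ring)).2 hzy
  have hqz : D.Adj q' z := by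
    by_contra hn
    exact hzy ((T.rule h.nodup h.length z
      ((h.segP.append (h.px T) (h.segQ.cons (h.xq T))).cons h.yp) h.qy
      (List.perm_iff_count.2 fun a => by
        simp only [List.count_append, List.count_cons]; ring)).2 hn)
  rcases h.mem_cases T v with rfl | rfl | rfl | hvP | hvQ
  · exact h.nxz.2 hv
  · exact hzy hv
  · exact T.loopless _ hv
  · rcases h.segP.exists_prev hvP with rfl | ⟨l₁, l₂, u, e, h1, h2, h3⟩
    · exact hvy h.yp
    · have huy : D.Adj u y := by
        by_contra hn
        exact hvy ((h.rule_y T e h1 h2 h3).2 hn)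
      subst e
      exact T.not_ham h.nodup h.length
        (((h1.append huy (h.segQ.cons hyq)).append hqz (h3.cons hv)).cons (h.xp T)) (h.px T)
        (List.perm_iff_count.2 fun a => by
          simp only [List.count_append, List.count_cons]; ring)
  · rcases h.segQ.exists_prev hvQ with rfl | ⟨l₁, l₂, u, e, h1, h2, h3⟩
    · exact hvy hyq
    · exact hvy (h.swap.z_adj_of_y_adj T e h1 h2 h3 hv)

end TwoGap

/-! ### Exchanging the omitted vertex with a gap -/

/-- `l` lists, in cyclic order, a cycle that misses exactly the vertex `x`. -/
structure Omits {V : Type*} (D : Digraph V) (m : ℕ) (x : V) (l : List V) : Prop where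
  nodup : (x :: l).Nodup
  length : l.length = 2 * m
  closed : ∃ u v, D.Seg u l v ∧ D.Adj v u

/-- The vertices other than `x` that are not adjacent to `x`. -/
def gaps {V : Type*} (D : Digraph V) (x : V) : Set V := {v | v ≠ x ∧ D.NonAdjacent x v}

/-- Some cycle misses exactly `x`, and some arc joins two vertices not adjacent to `x`. -/
def Bad {V : Type*} (D : Digraph V) (m : ℕ) (x : V) : Prop :=
  (∃ l, D.Omits m x l) ∧ ∃ f ∈ D.gaps x, ∃ g ∈ D.gaps x, D.Adj f g

theorem exists_cyclic_switch {α : Type*} (p : α → Prop) {l : List α} {a b : α} (ha : a ∈ l)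
    (hb : b ∈ l) (hpa : p a) (hpb : ¬ p b) :
    ∃ u w t, l.IsRotated (u :: w :: t) ∧ p u ∧ ¬ p w := by
  have key : ∀ (t : List α) (a : α), p a → (∃ b ∈ t, ¬ p b) →
      ∃ s u w s', a :: t = s ++ u :: w :: s' ∧ p u ∧ ¬ p w := by
    intro t
    induction t with
    | nil => simp
    | cons c t ih =>
      intro a ha hb
      by_cases hc : p c
      · obtain ⟨b, hbt, hpb⟩ := hb
        have hbt' : b ∈ t := by
          rcases List.mem_cons.1 hbt with rfl | h
          · exact absurd hc hpb
          · exact h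
        obtain ⟨s, u, w, s', e, hu, hw⟩ := ih c hc ⟨b, hbt', hpb⟩
        exact ⟨a :: s, u, w, s', by rw [e]; rfl, hu, hw⟩
      · exact ⟨[], a, c, t, rfl, ha, hc⟩
  obtain ⟨s, t, rfl⟩ := List.append_of_mem ha
  have hb' : b ∈ t ++ s := by
    simp only [List.mem_append, List.mem_cons] at hb ⊢
    rcases hb with h | rfl | h
    · exact Or.inr h
    · exact absurd hpa hpb
    · exact Or.inl h
  obtain ⟨r, u, w, r', e, hu, hw⟩ := key (t ++ s) a hpa ⟨b, hb', hpb⟩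
  refine ⟨u, w, r' ++ r, ?_, hu, hw⟩
  have h1 : (s ++ a :: t).IsRotated ((a :: t) ++ s) := List.isRotated_append
  have h2 : (a :: t) ++ s = r ++ (u :: w :: r') := by simpa using e
  have h3 : (r ++ (u :: w :: r')).IsRotated ((u :: w :: r') ++ r) := List.isRotated_append
  exact (h2 ▸ h1).trans h3

theorem gaps_symm {V : Type*} {D : Digraph V} {x y : V} (hy : y ∈ D.gaps x) : x ∈ D.gaps y :=
  ⟨hy.1.symm, hy.2.2, hy.2.1⟩

namespace Omits

variable {V : Type*} {D : Digraph V} {m : ℕ} {x f u w : V} {l l₁ l₂ t : List V}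

theorem rotate (h : D.Omits m x (l₁ ++ l₂)) : D.Omits m x (l₂ ++ l₁) := by
  refine ⟨(List.Perm.cons x List.perm_append_comm).nodup_iff.1 h.nodup, ?_, ?_⟩
  · rw [← h.length, List.length_append, List.length_append, add_comm]
  · obtain ⟨u, v, hs, hvu⟩ := h.closed
    rcases eq_or_ne l₁ [] with rfl | h1
    · exact ⟨u, v, by simpa using hs, hvu⟩
    rcases eq_or_ne l₂ [] with rfl | h2
    · exact ⟨u, v, by simpa using hs, hvu⟩
    obtain ⟨a, b, ha, hab, hb⟩ := hs.split h1 h2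
    exact ⟨b, a, hb.append hvu ha, hab⟩

theorem isRotated (h : D.Omits m x l₁) (hr : l₁.IsRotated l₂) : D.Omits m x l₂ := by
  obtain ⟨n, rfl⟩ := hr
  rw [List.rotate_eq_drop_append_take_mod]
  exact rotate (by rwa [List.take_append_drop])

theorem ne_of_mem (h : D.Omits m x l) (hu : u ∈ l) : u ≠ x := by
  rintro rfl
  exact (List.nodup_cons.1 h.nodup).1 hu

theorem exists_rotate (h : D.Omits m x l) (hu : u ∈ l) : ∃ t, D.Omits m x (u :: t) := by
  obtain ⟨s, t, rfl⟩ := List.append_of_mem hu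
  exact ⟨t ++ s, h.rotate⟩

theorem adj_of_cons (h : D.Omits m x (u :: w :: t)) : D.Adj u w := by
  obtain ⟨a, b, hs, -⟩ := h.closed
  have := hs.head_eq
  subst this
  obtain ⟨c, hc, hs'⟩ := hs.cons_cases (by simp)
  have := hs'.head_eq
  subst this
  exact hc

theorem length_eq (h : D.Omits m x l) : (x :: l).length = 2 * m + 1 := by
  simp [h.length]

variable [Finite V]

theorem mem (h : D.Omits m x l) (T : D.Tight m) (hu : u ≠ x) : u ∈ l := by
  classical
  have := Fintype.ofFinite V
  have h1 : (x :: l).toFinset = Finset.univ := by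
    rw [← Finset.card_eq_iff_eq_univ, List.toFinset_card_of_nodup h.nodup, h.length_eq,
      ← Nat.card_eq_fintype_card, T.card]
  have h2 : u ∈ (x :: l).toFinset := h1 ▸ Finset.mem_univ u
  rw [List.mem_toFinset, List.mem_cons] at h2
  exact h2.resolve_left hu

theorem deg (h : D.Omits m x l) (T : D.Tight m) : D.inDeg x = m ∧ D.outDeg x = m := by
  obtain ⟨u, v, hs, hvu⟩ := h.closed
  exact T.deg_eq h.nodup h.length_eq x hs hvu (List.Perm.refl _)

theorem rule (h : D.Omits m x (u :: w :: t)) (T : D.Tight m) : D.Adj x w ↔ ¬ D.Adj u x := by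
  have h' : D.Omits m x ((w :: t) ++ [u]) := h.rotate (l₁ := [u])
  obtain ⟨a, b, hs, hba⟩ := h'.closed
  have h1 := hs.last_eq
  have h2 := Seg.head_eq (l := t ++ [u]) hs
  subst h1 h2
  exact T.rule h'.nodup h'.length_eq x hs hba (List.Perm.refl _)

/-- The rule for the closing arc. -/
theorem rule_last (h : D.Omits m x (w :: (t ++ [u]))) (T : D.Tight m) :
    D.Adj x w ↔ ¬ D.Adj u x :=
  rule (h.rotate (l₁ := w :: t) (l₂ := [u])) T

/-- Neither arc between `x` and `f` exists, so the rule forces arcs from the predecessor of `f` to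
`x` and from `x` to the successor of `f`. -/
theorem exchange_head (h : D.Omits m x (f :: t)) (T : D.Tight m) (hf : f ∈ D.gaps x) :
    D.Omits m f (x :: t) := by
  refine ⟨(List.Perm.swap _ _ _).nodup_iff.1 h.nodup, by simpa using h.length, ?_⟩
  have ht : t ≠ [] := by
    rintro rfl
    have h1 := h.length
    simp at h1
    omega
  obtain ⟨a, b, hs, hba⟩ := h.closed
  have := hs.head_eq
  subst this
  obtain ⟨c, hc, hs'⟩ := hs.cons_cases ht
  have hbx : D.Adj b x := by
    by_contra hn
    exact hf.2.1 ((T.rule h.nodup h.length_eq x hs hba (List.Perm.refl _)).2 hn)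
  have hxc : D.Adj x c :=
    (T.rule h.nodup h.length_eq x (hs'.concat hba) hc
      (List.Perm.cons x List.perm_append_comm)).2 hf.2.2
  exact ⟨x, b, hs'.cons hxc, hbx⟩

theorem exchange (h : D.Omits m x (l₁ ++ f :: l₂)) (T : D.Tight m) (hf : f ∈ D.gaps x) :
    D.Omits m f (l₁ ++ x :: l₂) :=
  rotate (l₁ := x :: l₂) (h.rotate.exchange_head (t := l₂ ++ l₁) T hf)

theorem exists_twoGap {y z : V} {P Q : List V} (h : D.Omits m x (y :: (P ++ z :: Q)))
    (T : D.Tight m) (hy : y ∈ D.gaps x) (hz : z ∈ D.gaps x) :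
    ∃ p p' q q', D.TwoGap m x y P z Q p p' q q' := by
  have hP : P ≠ [] := by
    rintro rfl
    exact hz.2.1 ((h.rule (t := Q) T).2 hy.2.2)
  have hQ : Q ≠ [] := by
    rintro rfl
    exact hy.2.1 ((h.rule_last T).2 hz.2.2)
  obtain ⟨a, b, hs, hba⟩ := h.closed
  have := hs.head_eq
  subst this
  obtain ⟨p, hyp, hs1⟩ := hs.cons_cases (by simp)
  obtain ⟨p', c, hP', hpc, hs2⟩ := hs1.split hP (by simp)
  have := hs2.head_eq
  subst this
  obtain ⟨q, hzq, hs3⟩ := hs2.cons_cases hQ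
  exact ⟨p, p', q, b, h.nodup, h.length_eq, hP', hs3, hyp, hpc, hzq, hba, hy.2, hz.2⟩

theorem exists_twoGap_of_mem {y z : V} (h : D.Omits m x l)
    (T : D.Tight m) (hy : y ∈ D.gaps x) (hz : z ∈ D.gaps x) (hyz : y ≠ z) :
    ∃ P Q p p' q q', D.TwoGap m x y P z Q p p' q q' := by
  obtain ⟨t, ht⟩ := h.exists_rotate (h.mem T hy.1)
  have hzt : z ∈ t := (List.mem_cons.1 (ht.mem T hz.1)).resolve_left hyz.symm
  obtain ⟨P, Q, rfl⟩ := List.append_of_mem hzt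
  exact ⟨P, Q, ht.exists_twoGap T hy hz⟩

theorem gap_adj_symm {y z : V} (h : D.Omits m x l) (T : D.Tight m) (hy : y ∈ D.gaps x)
    (hz : z ∈ D.gaps x) (hyz : D.Adj y z) : D.Adj z y := by
  obtain ⟨P, Q, p, p', q, q', hG⟩ := h.exists_twoGap_of_mem T hy hz
    (by rintro rfl; exact T.loopless _ hyz)
  exact hG.adj_symm T hyz

theorem gap_twins {y z : V} (h : D.Omits m x l) (T : D.Tight m) (hy : y ∈ D.gaps x)
    (hz : z ∈ D.gaps x) (hne : y ≠ z) (hyz : D.NonAdjacent y z) :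
    D.outNbhd x = D.outNbhd y ∧ D.inNbhd x = D.inNbhd y := by
  obtain ⟨P, Q, p, p', q, q', hG⟩ := h.exists_twoGap_of_mem T hy hz hne
  exact hG.twins T hyz

theorem exists_omits_gap (h : D.Omits m x l) (T : D.Tight m) (hf : f ∈ D.gaps x) :
    ∃ l', D.Omits m f l' := by
  obtain ⟨t, ht⟩ := h.exists_rotate (h.mem T hf.1)
  exact ⟨_, ht.exchange_head T hf⟩

end Omits

/-! ### Arcs between a bad vertex, its gaps and its one-way neighbours -/

namespace Bad

variable {V : Type*} {D : Digraph V} {m : ℕ} {x f g u w : V} {l t : List V}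

theorem exists_other (hx : D.Bad m x) (T : D.Tight m) (f : V) : ∃ g ∈ D.gaps x, g ≠ f := by
  obtain ⟨-, a, ha, b, hb, hab⟩ := hx
  rcases eq_or_ne a f with rfl | h
  · exact ⟨b, hb, by rintro rfl; exact T.loopless _ hab⟩
  · exact ⟨a, ha, h⟩

variable [Finite V]

/-- A gap `c` that dominates a gap `d` cannot be a twin of `x`, since `x` does not dominate `d`. So
`c` is adjacent to every other gap, and by `Omits.gap_adj_symm` in both directions. -/
theorem complete (hx : D.Bad m x) (T : D.Tight m) (hf : f ∈ D.gaps x) (hg : g ∈ D.gaps x)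
    (hne : f ≠ g) : D.Adj f g := by
  obtain ⟨⟨l, hl⟩, a, ha, b, hb, hab⟩ := hx
  have hnt : ∀ {c d e : V}, c ∈ D.gaps x → d ∈ D.gaps x → e ∈ D.gaps x → D.Adj c d → c ≠ e →
      D.Adj c e := by
    intro c d e hc hd he hcd hce
    by_contra hn
    have hn' : ¬ D.Adj e c := fun h => hn (hl.gap_adj_symm T he hc h)
    have h1 := (hl.gap_twins T hc he hce ⟨hn, hn'⟩).1
    have h2 : d ∈ D.outNbhd x := h1 ▸ hcd
    exact hd.2.1 h2
  have hfa : ∃ d ∈ D.gaps x, D.Adj f d := by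
    rcases eq_or_ne f a with rfl | h
    · exact ⟨b, hb, hab⟩
    · exact ⟨a, ha, hl.gap_adj_symm T ha hf (hnt ha hb hf hab h.symm)⟩
  obtain ⟨d, hd, hfd⟩ := hfa
  exact hnt hf hd hg hfd hne

/-- Both `x` and `w` are gaps of `f`. If they were non-adjacent, `f` and `x` would be twins, yet `f`
dominates another gap of `x`. -/
theorem double_of_gap (hx : D.Bad m x) (T : D.Tight m) (hf : f ∈ D.gaps x) (hw : w ∈ D.gaps f)
    (hwx : w ≠ x) : D.Adj x w ∧ D.Adj w x := by
  obtain ⟨l, hl⟩ := hx.1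
  obtain ⟨l', hl'⟩ := hl.exists_omits_gap T hf
  have hxf := gaps_symm hf
  by_cases h1 : D.Adj x w
  · exact ⟨h1, hl'.gap_adj_symm T hxf hw h1⟩
  by_cases h2 : D.Adj w x
  · exact absurd (hl'.gap_adj_symm T hw hxf h2) h1
  obtain ⟨g, hg, hgf⟩ := hx.exists_other T f
  have h3 := (hl'.gap_twins T hxf hw hwx.symm ⟨h1, h2⟩).1
  have h4 : g ∈ D.outNbhd x := h3 ▸ hx.complete T hf hg hgf.symm
  exact absurd h4 hg.2.1

/-- A vertex that `x` dominates without being dominated by it dominates every gap of `x`. -/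
theorem adj_gap (hx : D.Bad m x) (T : D.Tight m) (hf : f ∈ D.gaps x) {a : V} (hxa : D.Adj x a)
    (hax : ¬ D.Adj a x) : D.Adj a f := by
  by_contra haf
  obtain ⟨l, hl⟩ := hx.1
  have hane : a ≠ x := by rintro rfl; exact T.loopless _ hxa
  -- Going round the cycle from `f`, `u` is a counterexample whose predecessor `w` is not one.
  obtain ⟨w, u, t, hrot, hpw, hpu⟩ := exists_cyclic_switch
    (fun u => ¬ (D.Adj x u ∧ ¬ D.Adj u x ∧ ¬ D.Adj u f)) (hl.mem T hf.1) (hl.mem T hane)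
    (fun h => hf.2.1 h.1) (not_not.2 ⟨hxa, hax, haf⟩)
  rw [not_not] at hpu
  obtain ⟨hxu, hux, huf⟩ := hpu
  have ht : D.Omits m x (w :: u :: t) := hl.isRotated hrot
  have hwx : ¬ D.Adj w x := (ht.rule T).1 hxu
  have hwne : w ≠ x := ht.ne_of_mem (by simp)
  have hune : u ≠ x := ht.ne_of_mem (by simp)
  -- Exchange `c` with `x`: since `w → c`, the rule excludes `c → u`. If `u → c` failed too, `u`
  -- would be a gap of `c`, hence joined to `x` both ways.
  have hstep : ∀ c ∈ D.gaps x, c ≠ w → D.Adj w c → D.Adj u c := by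
    intro c hc hcw hwc
    by_contra huc
    have hcu : c ≠ u := by rintro rfl; exact hc.2.1 hxu
    have hct : c ∈ t := by
      have := ht.mem T hc.1
      simp only [List.mem_cons] at this
      tauto
    obtain ⟨t₁, t₂, rfl⟩ := List.append_of_mem hct
    have hcc := Omits.exchange (l₁ := w :: u :: t₁) ht T hc
    have hn : ¬ D.Adj c u := fun h => (Omits.rule (t := t₁ ++ x :: t₂) hcc T).1 h hwc
    exact hux (hx.double_of_gap T hc ⟨hcu.symm, hn, huc⟩ hune).2
  -- Otherwise `w` dominates `f`, either as a one-way out-neighbour of `x` that is no counterexample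
  -- or as another gap, and this passes to `u`.
  have hwf : w = f := by
    by_contra hne
    by_cases hxw : D.Adj x w
    · exact hpw ⟨hxw, hwx, fun h => huf (hstep f hf (Ne.symm hne) h)⟩
    · exact huf (hstep f hf (Ne.symm hne) (hx.complete T ⟨hwne, hxw, hwx⟩ hf hne))
  subst hwf
  obtain ⟨g, hg, hgw⟩ := hx.exists_other T w
  have hug := hstep g hg hgw (hx.complete T hf hg hgw.symm)
  have hgt : g ∈ t := by
    have := ht.mem T hg.1
    have hgu : g ≠ u := by rintro rfl; exact hg.2.1 hxu
    simp only [List.mem_cons] at this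
    tauto
  obtain ⟨t₁, t₂, rfl⟩ := List.append_of_mem hgt
  obtain ⟨p, p', q, q', hG⟩ := Omits.exists_twoGap (P := u :: t₁) ht T hf hg
  have := hG.segP.head_eq
  subst this
  rcases eq_or_ne t₁ [] with rfl | ht1
  · have h1 : u = p' := Seg.last_eq (l := []) hG.segP
    exact hux (h1 ▸ hG.px T)
  · obtain ⟨w', hw', hs⟩ := hG.segP.cons_cases ht1
    exact huf (hG.adj_y_of_adj_z T (l₁ := [u]) rfl (seg_singleton u) hw' hs hug)

/-- A vertex that dominates `x` without being dominated by it is dominated by every gap of `x`. -/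
theorem gap_adj (hx : D.Bad m x) (T : D.Tight m) (hf : f ∈ D.gaps x) {b : V} (hbx : D.Adj b x)
    (hxb : ¬ D.Adj x b) : D.Adj f b := by
  by_contra hfb
  obtain ⟨l, hl⟩ := hx.1
  have hbne : b ≠ x := by rintro rfl; exact T.loopless _ hbx
  obtain ⟨u, w, t, hrot, hpu, hpw⟩ := exists_cyclic_switch
    (fun u => D.Adj u x ∧ ¬ D.Adj x u ∧ ¬ D.Adj f u) (hl.mem T hbne) (hl.mem T hf.1)
    ⟨hbx, hxb, hfb⟩ (fun h => hf.2.2 h.1)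
  obtain ⟨hux, hxu, hfu⟩ := hpu
  have ht : D.Omits m x (u :: w :: t) := hl.isRotated hrot
  have hxw : ¬ D.Adj x w := fun h => (ht.rule T).1 h hux
  have hwne : w ≠ x := ht.ne_of_mem (by simp)
  have hune : u ≠ x := ht.ne_of_mem (by simp)
  have hstep : ∀ c ∈ D.gaps x, c ≠ w → D.Adj c w → D.Adj c u := by
    intro c hc hcw hwc
    by_contra hcu'
    have hcu : c ≠ u := by rintro rfl; exact hc.2.2 hux
    have hct : c ∈ t := by
      have := ht.mem T hc.1
      simp only [List.mem_cons] at this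
      tauto
    obtain ⟨t₁, t₂, rfl⟩ := List.append_of_mem hct
    have hcc := Omits.exchange (l₁ := u :: w :: t₁) ht T hc
    have hn : ¬ D.Adj u c := (Omits.rule (t := t₁ ++ x :: t₂) hcc T).1 hwc
    exact hxu (hx.double_of_gap T hc ⟨hcu.symm, hcu', hn⟩ hune).1
  have hwf : w = f := by
    by_contra hne
    by_cases hwx : D.Adj w x
    · exact hpw ⟨hwx, hxw, fun h => hfu (hstep f hf (Ne.symm hne) h)⟩
    · exact hfu (hstep f hf (Ne.symm hne) (hx.complete T hf ⟨hwne, hxw, hwx⟩ (Ne.symm hne)))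
  subst hwf
  obtain ⟨g, hg, hgw⟩ := hx.exists_other T w
  have hgu := hstep g hg hgw (hx.complete T hg hf hgw)
  have hgt : g ∈ t := by
    have := ht.mem T hg.1
    have hgu : g ≠ u := by rintro rfl; exact hg.2.2 hux
    simp only [List.mem_cons] at this
    tauto
  obtain ⟨t₁, t₂, rfl⟩ := List.append_of_mem hgt
  have ht' : D.Omits m x (g :: ((t₂ ++ [u]) ++ w :: t₁)) := by
    have := ht.rotate (l₁ := u :: w :: t₁) (l₂ := g :: t₂)
    simpa using this
  obtain ⟨p, p', q, q', hG⟩ := ht'.exists_twoGap T hg hf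
  have := hG.segP.last_eq
  subst this
  rcases eq_or_ne t₂ [] with rfl | ht1
  · have h1 : u = p := Seg.head_eq (l := []) hG.segP
    exact hxu (h1 ▸ hG.xp T)
  · obtain ⟨a, b, hs1, hab, hs2⟩ := hG.segP.split ht1 (by simp)
    have := hs2.head_eq
    subst this
    exact hfu (hG.z_adj_of_y_adj T rfl hs1 hab hs2 hgu)

end Bad

/-! ### A bad vertex with the most gaps -/

theorem exists_first_exit {α : Type*} (p : α → Prop) {l : List α} {a b : α} (hpa : p a)
    (hb : b ∈ l) (hpb : ¬ p b) :
    ∃ l₁ u w l₂, a :: l = l₁ ++ u :: w :: l₂ ∧ (∀ v ∈ l₁, p v) ∧ p u ∧ ¬ p w := by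
  induction l generalizing a with
  | nil => simp at hb
  | cons c t ih =>
    by_cases hc : p c
    · have hbt : b ∈ t := by
        rcases List.mem_cons.1 hb with rfl | h
        · exact absurd hc hpb
        · exact h
      obtain ⟨l₁, u, w, l₂, e, h1, hu, hw⟩ := ih hc hbt
      refine ⟨a :: l₁, u, w, l₂, by rw [e]; rfl, ?_, hu, hw⟩
      intro v hv
      rcases List.mem_cons.1 hv with rfl | h
      · exact hpa
      · exact h1 v h
    · exact ⟨[], a, c, t, rfl, by simp, hpa, hc⟩

theorem exists_switch {α : Type*} (p : α → Prop) {l : List α} {a e : α} (ha : a ∈ l ++ [e])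
    (hpa : p a) (hpe : ¬ p e) :
    ∃ l₁ u w l₂, l ++ [e] = l₁ ++ u :: w :: l₂ ∧ p u ∧ ¬ p w := by
  obtain ⟨s, t, hst⟩ := List.append_of_mem ha
  have hne : t ≠ [] := by
    rintro rfl
    have := List.append_inj_right' hst (by simp)
    simp only [List.cons.injEq, and_true] at this
    exact hpe (this ▸ hpa)
  have he : e ∈ t := by
    obtain ⟨t', c, rfl⟩ := (List.eq_nil_or_concat t).resolve_left hne
    rw [List.concat_eq_append] at hst ⊢
    have h2 : l ++ [e] = (s ++ a :: t') ++ [c] := by simpa using hst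
    have := List.append_inj_right' h2 (by simp)
    simp only [List.cons.injEq, and_true] at this
    simp [this]
  obtain ⟨l₁, u, w, l₂, h1, -, hu, hw⟩ := exists_first_exit p hpa he hpe
  exact ⟨s ++ l₁, u, w, l₂, by rw [hst, h1]; simp, hu, hw⟩

section

variable {V : Type*} [Finite V] {D : Digraph V} {m : ℕ} {x f r u w : V} {l l₁ l₂ t : List V}

theorem Omits.rule_mid (h : D.Omits m x (l₁ ++ u :: w :: l₂)) (T : D.Tight m) :
    D.Adj x w ↔ ¬ D.Adj u x :=
  Omits.rule (t := l₂ ++ l₁) h.rotate T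

/-- The rule at `x` excludes `w → x`, so `w` is a gap or a one-way out-neighbour of `x`, and
dominates `f` either way. After exchanging `f` with `x`, the rule at `f` excludes `f → r`. -/
theorem Omits.not_gap_adj (h : D.Omits m x (l₁ ++ w :: r :: l₂)) (T : D.Tight m) (hx : D.Bad m x)
    (hf : f ∈ D.gaps x) (hwf : w ≠ f) (hxr : D.Adj x r) : ¬ D.Adj f r := by
  have h' : D.Omits m x (w :: r :: (l₂ ++ l₁)) := h.rotate
  have hwx := (h'.rule T).1 hxr
  have hwne : w ≠ x := h'.ne_of_mem (by simp)
  have hadj : D.Adj w f := by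
    by_cases hxw : D.Adj x w
    · exact hx.adj_gap T hf hxw hwx
    · exact hx.complete T ⟨hwne, hxw, hwx⟩ hf hwf
  have hft : f ∈ l₂ ++ l₁ := by
    have := h'.mem T hf.1
    have hfr : f ≠ r := by rintro rfl; exact hf.2.1 hxr
    simp only [List.mem_cons] at this
    tauto
  obtain ⟨t₁, t₂, e⟩ := List.append_of_mem hft
  rw [e] at h'
  have hcc := Omits.exchange (l₁ := w :: r :: t₁) h' T hf
  exact fun hfr => (Omits.rule (t := t₁ ++ x :: t₂) hcc T).1 hfr hadj

theorem Omits.not_adj_gap (h : D.Omits m x (l₁ ++ r :: w :: l₂)) (T : D.Tight m) (hx : D.Bad m x)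
    (hf : f ∈ D.gaps x) (hwf : w ≠ f) (hrx : D.Adj r x) : ¬ D.Adj r f := by
  have h' : D.Omits m x (r :: w :: (l₂ ++ l₁)) := h.rotate
  have hxw : ¬ D.Adj x w := fun hn => (h'.rule T).1 hn hrx
  have hwne : w ≠ x := h'.ne_of_mem (by simp)
  have hadj : D.Adj f w := by
    by_cases hwx : D.Adj w x
    · exact hx.gap_adj T hf hwx hxw
    · exact hx.complete T hf ⟨hwne, hxw, hwx⟩ hwf.symm
  have hft : f ∈ l₂ ++ l₁ := by
    have := h'.mem T hf.1
    have hfr : f ≠ r := by rintro rfl; exact hf.2.2 hrx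
    simp only [List.mem_cons] at this
    tauto
  obtain ⟨t₁, t₂, e⟩ := List.append_of_mem hft
  rw [e] at h'
  have hcc := Omits.exchange (l₁ := r :: w :: t₁) h' T hf
  exact (Omits.rule (t := t₁ ++ x :: t₂) hcc T).1 hadj

/-- `x` has as many gaps as neighbours joined to it by two opposite arcs. -/
theorem Omits.ncard_gaps (h : D.Omits m x l) (T : D.Tight m) :
    (D.gaps x).ncard = (D.outNbhd x ∩ D.inNbhd x).ncard := by
  obtain ⟨hin, hout⟩ := h.deg T
  rw [inDeg] at hin
  rw [outDeg] at hout
  have h1 := Set.ncard_union_add_ncard_inter (D.outNbhd x) (D.inNbhd x)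
  have h2 : D.gaps x = (insert x (D.outNbhd x ∪ D.inNbhd x))ᶜ := by
    ext v
    simp [gaps, NonAdjacent, outNbhd, inNbhd]
  have h3 : x ∉ D.outNbhd x ∪ D.inNbhd x := by
    rintro (h | h) <;> exact T.loopless x h
  have h4 := Set.ncard_add_ncard_compl (insert x (D.outNbhd x ∪ D.inNbhd x))
  rw [Set.ncard_insert_of_notMem h3, ← h2, T.card] at h4
  omega

theorem Bad.exists_double (hx : D.Bad m x) (T : D.Tight m) : ∃ r, D.Adj x r ∧ D.Adj r x := by
  obtain ⟨⟨l, hl⟩, f, hf, -⟩ := hx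
  have h1 : 0 < (D.gaps x).ncard := (Set.ncard_pos (Set.toFinite _)).2 ⟨f, hf⟩
  rw [hl.ncard_gaps T, Set.ncard_pos (Set.toFinite _)] at h1
  obtain ⟨r, hr⟩ := h1
  exact ⟨r, hr⟩

theorem bad_of_gap (T : D.Tight m) (h : D.Omits m x l) (hf : f ∈ D.gaps x) (hr : r ∈ D.gaps f)
    (hxr : D.Adj x r) : D.Bad m f :=
  ⟨h.exists_omits_gap T hf, x, gaps_symm hf, r, hr, hxr⟩

/-- A one-way out-neighbour run of `x` followed later by a one-way in-neighbour that precedes a gap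
gives a Hamiltonian cycle. -/
theorem Bad.false_of_runs (hx : D.Bad m x) (T : D.Tight m) {L M₁ M₂ : List V} {a b g : V}
    (h : D.Omits m x (f :: ((L ++ [a] ++ r :: (M₁ ++ [b])) ++ g :: M₂)))
    (hf : f ∈ D.gaps x) (hg : g ∈ D.gaps x) (hxa : D.Adj x a) (hax : ¬ D.Adj a x)
    (hrx : D.Adj r x) (hbx : D.Adj b x) (hxb : ¬ D.Adj x b) : False := by
  classical
  obtain ⟨p, p', q, q', G⟩ := h.exists_twoGap T hf hg
  have := (Seg.last_eq (l := L ++ [a] ++ r :: M₁) (by simpa using G.segP) : b = p')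
  subst this
  obtain ⟨a', r', s1, har, s2⟩ := G.segP.split (by simp) (by simp)
  have := s1.last_eq
  subst this
  have := s2.head_eq
  subst this
  obtain ⟨s, hrs, s3⟩ := s2.cons_cases (by simp)
  have hxp := G.xp T
  have hqx := G.qx T
  have haf := hx.adj_gap T hf hxa hax
  have hag := hx.adj_gap T hg hxa hax
  have hfb := hx.gap_adj T hf hbx hxb
  have hxs : ¬ D.Adj x s := fun hn =>
    (G.rule_x T (l₁ := L ++ [a] ++ [r]) (l₂ := M₁ ++ [b]) (by simp) (s1.concat har) hrs s3).1 hn hrx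
  have hnd := h.nodup
  have hsmem := s3.head_mem
  have hsf : s ≠ f := by
    rintro rfl
    simp only [List.nodup_cons, List.mem_append, List.mem_cons] at hnd hsmem
    tauto
  have hsx : s ≠ x := by
    rintro rfl
    simp only [List.nodup_cons, List.mem_append, List.mem_cons] at hnd hsmem
    tauto
  have hfs : D.Adj f s := by
    by_cases hsx' : D.Adj s x
    · exact hx.gap_adj T hf hsx' hxs
    · exact hx.complete T hf ⟨hsx, hxs, hsx'⟩ hsf.symm
  by_cases hbr : D.Adj b r
  · rcases eq_or_ne M₁ [] with rfl | hM
    · exact T.not_ham G.nodup G.length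
        (((((s1.cons hxp).append hag (G.segQ.cons G.zq)).append G.qy
          (seg_singleton f)).concat hfb).concat hbr) hrx
        (List.perm_iff_count.2 fun a => by
          simp only [List.count_append, List.count_cons, List.count_nil]; ring)
    · obtain ⟨s', b', s4, hsb, s5⟩ := s3.split hM (by simp)
      have := s5.head_eq
      subst this
      have hsx'' : D.Adj s' x := by
        by_contra hn
        exact hxb ((G.rule_x T (l₁ := L ++ [a] ++ r :: M₁) (l₂ := [b]) (by simp)
          (s1.append har (s4.cons hrs)) hsb s5).2 hn)
      exact T.not_ham G.nodup G.length
        (((((s1.cons hxp).append hag (G.segQ.cons G.zq)).append G.qy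
          (seg_singleton f)).concat hfb).append hbr (s4.cons hrs)) hsx''
        (List.perm_iff_count.2 fun a => by
          simp only [List.count_append, List.count_cons, List.count_nil]; ring)
  · have hrg : D.Adj r g := by
      refine (T.rule G.nodup G.length r
        (((G.segQ.cons G.zq).append hqx (s1.cons hxp)).append haf (s3.cons hfs)) G.pz
        (List.perm_iff_count.2 fun a => by
          simp only [List.count_append, List.count_cons, List.count_nil]; ring)).2 hbr
    exact T.not_ham G.nodup G.length
      ((((s1.cons hxp).concat har).append hrg (G.segQ.cons G.zq)).append G.qy (s3.cons hfs)) hbx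
      (List.perm_iff_count.2 fun a => by
        simp only [List.count_append, List.count_cons, List.count_nil]; ring)

/-- At a bad vertex with the largest number of gaps all arcs come in opposite pairs. -/
theorem Bad.symm_of_max (hx : D.Bad m x) (T : D.Tight m)
    (hmax : ∀ y, D.Bad m y → (D.gaps y).ncard ≤ (D.gaps x).ncard) :
    D.outNbhd x = D.inNbhd x := by
  obtain ⟨l, hl⟩ := hx.1
  obtain ⟨hin, hout⟩ := hl.deg T
  by_contra hne
  have h1 : ¬ D.outNbhd x ⊆ D.inNbhd x := fun h =>
    hne (Set.eq_of_subset_of_ncard_le h (le_of_eq (hin.trans hout.symm)) (Set.toFinite _))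
  have h2 : ¬ D.inNbhd x ⊆ D.outNbhd x := fun h =>
    hne (Set.eq_of_subset_of_ncard_le h (le_of_eq (hout.trans hin.symm)) (Set.toFinite _)).symm
  rw [Set.not_subset] at h1 h2
  obtain ⟨a₀, hxa₀, ha₀x⟩ := h1
  obtain ⟨b₀, hb₀x, hxb₀⟩ := h2
  change D.Adj x a₀ at hxa₀
  change ¬ D.Adj a₀ x at ha₀x
  change D.Adj b₀ x at hb₀x
  change ¬ D.Adj x b₀ at hxb₀
  have ha₀ne : a₀ ≠ x := by rintro rfl; exact T.loopless _ hxa₀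
  have hb₀ne : b₀ ≠ x := by rintro rfl; exact T.loopless _ hb₀x
  obtain ⟨f, a, t, hrot, hpf, hpa⟩ := exists_cyclic_switch
    (fun u => ¬ (D.Adj x u ∧ ¬ D.Adj u x)) (hl.mem T hb₀ne) (hl.mem T ha₀ne)
    (fun h => hxb₀ h.1) (not_not.2 ⟨hxa₀, ha₀x⟩)
  rw [not_not] at hpa
  obtain ⟨hxa, hax⟩ := hpa
  have ht := hl.isRotated hrot
  have hfx : ¬ D.Adj f x := (ht.rule T).1 hxa
  have hf : f ∈ D.gaps x :=
    ⟨ht.ne_of_mem (by simp), fun h => hpf ⟨h, hfx⟩, hfx⟩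
  have hnd := ht.nodup
  rcases List.eq_nil_or_concat t with rfl | ⟨t', e, rfl⟩
  · exact hf.2.1 ((Omits.rule_last (t := []) ht T).2 hax)
  rw [List.concat_eq_append] at ht hnd
  have hex : D.Adj e x := by
    by_contra hn
    exact hf.2.1 ((Omits.rule_last (t := a :: t') ht T).2 hn)
  -- If `e` were a one-way in-neighbour, every vertex joined to `x` in both directions would be a
  -- gap of `f`. Together with `x` itself this gives the bad vertex `f` more gaps than `x` has, by
  -- `ncard_gaps`.
  have hxe : D.Adj x e := by
    by_contra hxe
    obtain ⟨r, hxr, hrx⟩ := hx.exists_double T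
    have hR : ∀ r, D.Adj x r → D.Adj r x → r ∈ D.gaps f := by
      intro r hxr hrx
      have hrne : r ≠ x := by rintro rfl; exact T.loopless _ hxr
      have hrf : r ≠ f := by rintro rfl; exact hf.2.1 hxr
      have hra : r ≠ a := by rintro rfl; exact hax hrx
      have hre : r ≠ e := by rintro rfl; exact hxe hxr
      have hrt : r ∈ t' := by
        have := ht.mem T hrne
        simp only [List.mem_cons, List.mem_append, List.not_mem_nil, or_false] at this
        tauto
      obtain ⟨s₁, s₂, rfl⟩ := List.append_of_mem hrt
      obtain ⟨k₁, w, hk⟩ := (List.eq_nil_or_concat (a :: s₁)).resolve_left (by simp)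
      rw [List.concat_eq_append] at hk
      obtain ⟨w', k₂, hk'⟩ := List.exists_cons_of_ne_nil (l := s₂ ++ [e]) (by simp)
      have e1 : f :: a :: (s₁ ++ r :: s₂ ++ [e]) = (f :: k₁) ++ w :: r :: (s₂ ++ [e]) := by
        have : f :: a :: (s₁ ++ r :: s₂ ++ [e]) = f :: ((a :: s₁) ++ r :: (s₂ ++ [e])) := by simp
        rw [this, hk]
        simp
      have e2 : f :: a :: (s₁ ++ r :: s₂ ++ [e]) = (f :: a :: s₁) ++ r :: w' :: k₂ := by
        rw [← hk']
        simp
      have hwf : w ≠ f := by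
        rintro rfl
        have h1 : w ∈ a :: s₁ := by rw [hk]; simp
        simp only [List.nodup_cons, List.mem_cons, List.mem_append] at hnd h1
        tauto
      have hwf' : w' ≠ f := by
        rintro rfl
        have h1 : w' ∈ s₂ ++ [e] := by rw [hk']; simp
        simp only [List.nodup_cons, List.mem_cons, List.mem_append] at hnd h1
        tauto
      exact ⟨hrf, Omits.not_gap_adj (e1 ▸ ht) T hx hf hwf hxr,
        Omits.not_adj_gap (e2 ▸ ht) T hx hf hwf' hrx⟩
    have hbf := bad_of_gap T hl hf (hR r hxr hrx) hxr
    have hle := hmax f hbf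
    have hsub : insert x (D.outNbhd x ∩ D.inNbhd x) ⊆ D.gaps f := by
      intro v hv
      rcases hv with rfl | hv
      · exact gaps_symm hf
      · exact hR v hv.1 hv.2
    have hlt := Set.ncard_le_ncard hsub (Set.toFinite _)
    rw [Set.ncard_insert_of_notMem (fun h => T.loopless x h.1), ← hl.ncard_gaps T] at hlt
    omega
  -- The run of one-way out-neighbours starting at `a` ends at `a'`; the rule makes its successor
  -- `r` a two-way neighbour.
  obtain ⟨L, a', r, L₂, hsplit, hL, ha', hr⟩ := exists_first_exit
    (fun u => D.Adj x u ∧ ¬ D.Adj u x) (l := t' ++ [e]) (b := e) ⟨hxa, hax⟩ (by simp)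
    (fun h => h.2 hex)
  rw [hsplit] at ht hnd
  have hxr : D.Adj x r := (Omits.rule_mid (l₁ := f :: L) ht T).2 ha'.2
  have hrx : D.Adj r x := by
    by_contra hn
    exact hr ⟨hxr, hn⟩
  have hbL : b₀ ∈ L₂ := by
    have h1 := ht.mem T hb₀ne
    have hbf : b₀ ≠ f := by rintro rfl; exact hf.2.2 hb₀x
    have hba : b₀ ≠ a' := by rintro rfl; exact hxb₀ ha'.1
    have hbr : b₀ ≠ r := by rintro rfl; exact hxb₀ hxr
    have hbL : b₀ ∉ L := fun h => hxb₀ (hL _ h).1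
    simp only [List.mem_cons, List.mem_append] at h1
    tauto
  obtain ⟨L₃, c, rfl⟩ := (List.eq_nil_or_concat L₂).resolve_left (by rintro rfl; simp at hbL)
  rw [List.concat_eq_append] at ht hnd hsplit hbL
  have hce : c = e := by
    have h1 : (a :: t') ++ [e] = (L ++ a' :: r :: L₃) ++ [c] := by simpa using hsplit
    have := List.append_inj_right' h1 (by simp)
    simpa using this.symm
  subst hce
  -- After `r`, the last vertex of a run of one-way in-neighbours is followed by a gap `g`; the run
  -- ends because `e` is a two-way neighbour.
  obtain ⟨M₁, b, g, M₂, hM, hb, hg⟩ := exists_switch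
    (fun u => D.Adj u x ∧ ¬ D.Adj x u) hbL ⟨hb₀x, hxb₀⟩ (fun h => h.2 hxe)
  rw [hM] at ht hnd
  have e3 : f :: (L ++ a' :: r :: (M₁ ++ b :: g :: M₂)) =
      (f :: (L ++ a' :: r :: M₁)) ++ b :: g :: M₂ := by simp
  have hxg : ¬ D.Adj x g := fun h => (Omits.rule_mid (e3 ▸ ht) T).1 h hb.1
  have hgap : g ∈ D.gaps x := by
    refine ⟨ht.ne_of_mem (by simp), hxg, fun h => hg ⟨h, hxg⟩⟩
  have e4 : f :: (L ++ a' :: r :: (M₁ ++ b :: g :: M₂)) =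
      f :: ((L ++ [a'] ++ r :: (M₁ ++ [b])) ++ g :: M₂) := by simp
  exact hx.false_of_runs T (e4 ▸ ht) hf hgap ha'.1 ha'.2 hrx hb.1 hb.2

end

/-! ### Bad vertices with symmetric arcs: orders five, seven and larger -/

theorem isIsomorphic_of_labelling {V : Type*} {D : Digraph V} {n : ℕ} {E : Digraph (Fin n)}
    (g : Fin n → V) (hg : Function.Injective g) (hcard : Nat.card V = n) (hn : n ≠ 0)
    (h : ∀ i j, D.Adj (g i) (g j) ↔ E.Adj i j) : D.IsIsomorphic E := by
  have : Finite V := Nat.finite_of_card_ne_zero (hcard ▸ hn)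
  have hb : Function.Bijective g := (Nat.bijective_iff_injective_and_card g).2 ⟨hg, by simp [hcard]⟩
  refine ⟨RelIso.symm ⟨Equiv.ofBijective g hb, ?_⟩⟩
  intro i j
  exact h i j

section

variable {V : Type*} {D : Digraph V} {m : ℕ} {x f r u w : V} {l l₁ l₂ t : List V}

theorem Omits.gap_of_not_adj (h : D.Omits m x l) (hs : ∀ v, D.Adj x v ↔ D.Adj v x)
    (hu : u ∈ l) (hn : ¬ D.Adj x u) : u ∈ D.gaps x :=
  ⟨h.ne_of_mem hu, hn, fun h => hn ((hs u).2 h)⟩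

variable [Finite V]

theorem Omits.alternate (h : D.Omits m x (l₁ ++ u :: w :: l₂)) (T : D.Tight m)
    (hs : ∀ v, D.Adj x v ↔ D.Adj v x) : D.Adj x w ↔ ¬ D.Adj x u := by
  rw [h.rule_mid T, hs u]

theorem Bad.order_five (hx : D.Bad 2 x) (T : D.Tight 2) (hs : ∀ v, D.Adj x v ↔ D.Adj v x)
    {f₀ r₀ f₁ r₁ : V} (h : D.Omits 2 x [f₀, r₀, f₁, r₁]) (hf₀ : f₀ ∈ D.gaps x) :
    D.IsIsomorphic D5 ∨ ∃ E ∈ L1, D.IsIsomorphic E := by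
  have hr₀ : D.Adj x r₀ := (h.alternate T hs (l₁ := [])).2 hf₀.2.1
  have hf₁' : ¬ D.Adj x f₁ := fun hn => (h.alternate T hs (l₁ := [f₀])).1 hn hr₀
  have hr₁ : D.Adj x r₁ := (h.alternate T hs (l₁ := [f₀, r₀])).2 hf₁'
  have hf₁ := h.gap_of_not_adj hs (by simp) hf₁'
  have h' : D.Omits 2 x [f₁, r₁, f₀, r₀] := h.rotate (l₁ := [f₀, r₀])
  have hnd := h.nodup
  simp only [List.nodup_cons, List.mem_cons, List.not_mem_nil, or_false, not_or, not_false_eq_true,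
    List.nodup_nil, and_true] at hnd
  obtain ⟨⟨n1, n2, n3, n4⟩, ⟨n5, n6, n7⟩, ⟨n8, n9⟩, n10⟩ := hnd
  have a1 := hx.complete T hf₀ hf₁ n6
  have a2 := hx.complete T hf₁ hf₀ (Ne.symm n6)
  have a3 : D.Adj f₀ r₀ := h.adj_of_cons
  have a4 : D.Adj r₀ f₁ := (h.rotate (l₁ := [f₀])).adj_of_cons
  have a5 : D.Adj f₁ r₁ := h'.adj_of_cons
  have a6 : D.Adj r₁ f₀ := (h'.rotate (l₁ := [f₁])).adj_of_cons
  have b1 : ¬ D.Adj f₀ r₁ := h.not_gap_adj T hx hf₀ (Ne.symm n6) hr₁ (l₁ := [f₀, r₀])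
  have b2 : ¬ D.Adj r₀ f₀ := h.not_adj_gap T hx hf₀ (Ne.symm n6) ((hs _).1 hr₀) (l₁ := [f₀])
  have b3 : ¬ D.Adj f₁ r₀ := h'.not_gap_adj T hx hf₁ n6 hr₀ (l₁ := [f₁, r₁])
  have b4 : ¬ D.Adj r₁ f₁ := h'.not_adj_gap T hx hf₁ n6 ((hs _).1 hr₁) (l₁ := [f₁])
  have c1 := (hs _).1 hr₀
  have c2 := (hs _).1 hr₁
  have hll := T.loopless
  -- The omitted vertex is `y` in the notation of `D₅`, and the gap `f₀` is its `x`.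
  let g : Fin 5 → V := ![r₀, f₁, r₁, f₀, x]
  have hg : Function.Injective g := by
    rw [← List.nodup_ofFn]
    simp [g]
    tauto
  have iso : ∀ E : Digraph (Fin 5), (∀ i j, D.Adj (g i) (g j) ↔ E.Adj i j) → D.IsIsomorphic E :=
    fun E => isIsomorphic_of_labelling g hg (by rw [T.card]) (by norm_num)
  have l1 := hll r₀
  have l2 := hll f₁
  have l3 := hll r₁
  have l4 := hll f₀
  have l5 := hll x
  obtain ⟨-, e1, e2⟩ := hf₀
  obtain ⟨-, e3, e4⟩ := hf₁
  -- Only the arcs between `r₀` and `r₁` remain undetermined; they distinguish `D₅` from the members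
  -- of `L₁`.
  by_cases o1 : D.Adj r₀ r₁ <;> by_cases o2 : D.Adj r₁ r₀
  · refine Or.inr ⟨_, Or.inr (Or.inr rfl), iso _ ?_⟩
    intro i j
    fin_cases i <;> fin_cases j <;> simp [g, D5, addArcs, *]
  · refine Or.inr ⟨_, Or.inl rfl, iso _ ?_⟩
    intro i j
    fin_cases i <;> fin_cases j <;> simp [g, D5, addArcs, *]
  · refine Or.inr ⟨_, Or.inr (Or.inl rfl), iso _ ?_⟩
    intro i j
    fin_cases i <;> fin_cases j <;> simp [g, D5, addArcs, *]
  · refine Or.inl (iso _ ?_)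
    intro i j
    fin_cases i <;> fin_cases j <;> simp [g, D5, *]

/-- Rotating the cycle by two preserves the hypotheses, so it suffices to fix these arcs; three
rotations then determine the whole digraph. -/
theorem Bad.order_seven_arcs (hx : D.Bad 3 x) (T : D.Tight 3) (hs : ∀ v, D.Adj x v ↔ D.Adj v x)
    {f₀ r₀ f₁ r₁ f₂ r₂ : V} (h : D.Omits 3 x [f₀, r₀, f₁, r₁, f₂, r₂]) (hf₀ : f₀ ∈ D.gaps x) :
    (f₂ ∈ D.gaps x ∧ D.Adj x r₀ ∧ D.Adj r₀ x) ∧ D.Adj f₀ r₀ ∧ D.Adj r₀ f₁ ∧ D.Adj f₀ f₁ ∧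
      D.Adj f₁ f₀ ∧ ¬ D.Adj f₀ r₁ ∧ ¬ D.Adj r₁ f₀ ∧ ¬ D.Adj f₀ r₂ ∧ ¬ D.Adj r₀ f₀ ∧
      D.Adj r₀ r₁ ∧ ¬ D.Adj r₂ r₁ := by
  have hr₀ : D.Adj x r₀ := (h.alternate T hs (l₁ := [])).2 hf₀.2.1
  have hf₁' : ¬ D.Adj x f₁ := fun hn => (h.alternate T hs (l₁ := [f₀])).1 hn hr₀
  have hr₁ : D.Adj x r₁ := (h.alternate T hs (l₁ := [f₀, r₀])).2 hf₁'
  have hf₂' : ¬ D.Adj x f₂ := fun hn => (h.alternate T hs (l₁ := [f₀, r₀, f₁])).1 hn hr₁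
  have hr₂ : D.Adj x r₂ := (h.alternate T hs (l₁ := [f₀, r₀, f₁, r₁])).2 hf₂'
  have hf₁ := h.gap_of_not_adj hs (by simp) hf₁'
  have hf₂ := h.gap_of_not_adj hs (by simp) hf₂'
  have hnd := h.nodup
  simp only [List.nodup_cons, List.mem_cons, List.not_mem_nil, or_false, not_or, not_false_eq_true,
    List.nodup_nil, and_true] at hnd
  have n01 : f₀ ≠ f₁ := hnd.2.1.2.1
  have n02 : f₀ ≠ f₂ := hnd.2.1.2.2.2.1
  have n12 : f₁ ≠ f₂ := hnd.2.2.2.1.2.1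
  have n10 : r₁ ≠ f₀ := fun h => hnd.2.1.2.2.1 h.symm
  have b1 : ¬ D.Adj f₀ r₁ := h.not_gap_adj T hx hf₀ n01.symm hr₁ (l₁ := [f₀, r₀])
  have b2 : ¬ D.Adj r₁ f₀ :=
    h.not_adj_gap T hx hf₀ n02.symm ((hs _).1 hr₁) (l₁ := [f₀, r₀, f₁])
  have b3 : ¬ D.Adj r₁ f₁ :=
    h.not_adj_gap T hx hf₁ n12.symm ((hs _).1 hr₁) (l₁ := [f₀, r₀, f₁])
  have hc : D.Omits 3 f₀ [x, r₀, f₁, r₁, f₂, r₂] := h.exchange_head T hf₀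
  -- Since `r₁` is a gap of `f₀`, a second exchange makes `r₁` the omitted vertex; the rule at `r₁`
  -- settles `r₀ → r₁` and excludes `r₂ → r₁`.
  have hc' : D.Omits 3 r₁ [x, r₀, f₁, f₀, f₂, r₂] :=
    hc.exchange (l₁ := [x, r₀, f₁]) T ⟨n10, b1, b2⟩
  refine ⟨⟨hf₂, hr₀, (hs _).1 hr₀⟩, h.adj_of_cons, (h.rotate (l₁ := [f₀])).adj_of_cons,
    hx.complete T hf₀ hf₁ n01, hx.complete T hf₁ hf₀ n01.symm, b1, b2,
    h.not_gap_adj T hx hf₀ n02.symm hr₂ (l₁ := [f₀, r₀, f₁, r₁]),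
    h.not_adj_gap T hx hf₀ n01.symm ((hs _).1 hr₀) (l₁ := [f₀]), ?_, ?_⟩
  · by_contra hn
    exact b3 ((hc'.rule_mid (l₁ := [x]) T).2 hn)
  · exact (hc'.rule_last (t := [r₀, f₁, f₀, f₂]) T).1 ((hs _).1 hr₁)

theorem Bad.order_seven (hx : D.Bad 3 x) (T : D.Tight 3) (hs : ∀ v, D.Adj x v ↔ D.Adj v x)
    {f₀ r₀ f₁ r₁ f₂ r₂ : V} (h : D.Omits 3 x [f₀, r₀, f₁, r₁, f₂, r₂]) (hf₀ : f₀ ∈ D.gaps x) :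
    D.IsIsomorphic D7 := by
  obtain ⟨⟨hf₂, a1, a2⟩, a3, a4, a5, a6, a7, a8, a9, a10, a11, a12⟩ :=
    hx.order_seven_arcs T hs h hf₀
  have h2 : D.Omits 3 x [f₂, r₂, f₀, r₀, f₁, r₁] := h.rotate (l₁ := [f₀, r₀, f₁, r₁])
  obtain ⟨⟨hf₁, b1, b2⟩, b3, b4, b5, b6, b7, b8, b9, b10, b11, b12⟩ :=
    hx.order_seven_arcs T hs h2 hf₂
  have h1 : D.Omits 3 x [f₁, r₁, f₂, r₂, f₀, r₀] := h.rotate (l₁ := [f₀, r₀])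
  obtain ⟨-, c3, c4, c5, c6, c7, c8, c9, c10, c11, c12⟩ :=
    hx.order_seven_arcs T hs h1 hf₁
  obtain ⟨⟨-, c1, c2⟩, -⟩ := hx.order_seven_arcs T hs h1 hf₁
  have hnd := h.nodup
  have hll := T.loopless
  let g : Fin 7 → V := ![f₀, r₀, x, r₁, f₂, r₂, f₁]
  have hg : Function.Injective g := by
    rw [← List.nodup_ofFn]
    simp only [List.nodup_cons, List.mem_cons, List.not_mem_nil, or_false, not_or,
      not_false_eq_true, List.nodup_nil, and_true] at hnd
    simp [g]
    tauto
  refine isIsomorphic_of_labelling g hg (by rw [T.card]) (by norm_num) ?_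
  obtain ⟨-, e1, e2⟩ := hf₀
  obtain ⟨-, e3, e4⟩ := hf₁
  obtain ⟨-, e5, e6⟩ := hf₂
  have l0 := hll f₀
  have l1 := hll r₀
  have l2 := hll x
  have l3 := hll r₁
  have l4 := hll f₂
  have l5 := hll r₂
  have l6 := hll f₁
  clear hll hs hnd
  intro i j
  fin_cases i <;> fin_cases j <;> simp [g, D7, *]

/-- Here `r₀`, `r₁` are gaps of `f₃`, while `r₂` and the last vertex `e` are gaps of `f₁`. Both `f₃`
and `f₁` are bad, so `r₀ → r₁` and `e → r₂` by completeness, and `x r₀ r₁ f₂ f₀ f₁ f₃ … e r₂ x` is a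
Hamiltonian cycle. -/
theorem Bad.false_of_order_ge_nine (hx : D.Bad m x) (T : D.Tight m)
    (hs : ∀ v, D.Adj x v ↔ D.Adj v x) {f₀ r₀ f₁ r₁ f₂ r₂ f₃ r₃ : V} {M : List V}
    (h : D.Omits m x (f₀ :: r₀ :: f₁ :: r₁ :: f₂ :: r₂ :: f₃ :: r₃ :: M)) (hf₀ : f₀ ∈ D.gaps x) :
    False := by
  classical
  have hr₀ : D.Adj x r₀ := (h.alternate T hs (l₁ := [])).2 hf₀.2.1
  have hf₁' : ¬ D.Adj x f₁ := fun hn => (h.alternate T hs (l₁ := [f₀])).1 hn hr₀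
  have hr₁ : D.Adj x r₁ := (h.alternate T hs (l₁ := [f₀, r₀])).2 hf₁'
  have hf₂' : ¬ D.Adj x f₂ := fun hn => (h.alternate T hs (l₁ := [f₀, r₀, f₁])).1 hn hr₁
  have hr₂ : D.Adj x r₂ := (h.alternate T hs (l₁ := [f₀, r₀, f₁, r₁])).2 hf₂'
  have hf₃' : ¬ D.Adj x f₃ := fun hn => (h.alternate T hs (l₁ := [f₀, r₀, f₁, r₁, f₂])).1 hn hr₂
  have hf₁ := h.gap_of_not_adj hs (by simp) hf₁'
  have hf₂ := h.gap_of_not_adj hs (by simp) hf₂'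
  have hf₃ := h.gap_of_not_adj hs (by simp) hf₃'
  obtain ⟨K, w, e, hK⟩ : ∃ K w e, f₃ :: r₃ :: M = K ++ [w, e] := by
    rcases List.eq_nil_or_concat M with rfl | ⟨M', e, rfl⟩
    · exact ⟨[], f₃, r₃, rfl⟩
    · obtain ⟨K, w, hw⟩ := (List.eq_nil_or_concat (f₃ :: r₃ :: M')).resolve_left (by simp)
      refine ⟨K, w, e, ?_⟩
      rw [List.concat_eq_append] at hw ⊢
      have : f₃ :: r₃ :: (M' ++ [e]) = (f₃ :: r₃ :: M') ++ [e] := by simp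
      rw [this, hw]
      simp
  have hnd := h.nodup
  have hw : w ∈ f₃ :: r₃ :: M := by rw [hK]; simp
  have heq : f₀ :: r₀ :: f₁ :: r₁ :: f₂ :: r₂ :: f₃ :: r₃ :: M =
      (f₀ :: r₀ :: f₁ :: r₁ :: f₂ :: r₂ :: K) ++ w :: e :: [] := by rw [hK]; simp
  have he : e ∈ r₃ :: M := by
    have h1 : (f₃ :: r₃ :: M).getLast? = (K ++ [w, e]).getLast? := by rw [hK]
    have h2 : (r₃ :: M).getLast? = some e := by simpa using h1
    exact List.mem_of_mem_getLast? h2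
  simp only [List.nodup_cons, List.mem_cons, not_or] at hnd hw he
  obtain ⟨-, ⟨n1, n2, n3, n4, n5, n6, n7, n8⟩, ⟨m1, m2, m3, m4, m5, m6, m7⟩,
    ⟨k1, k2, k3, k4, k5, k6⟩, ⟨j1, j2, j3, j4, j5⟩, ⟨i1, i2, i3, i4⟩, ⟨q1, q2, q3⟩, -⟩ := hnd
  have hwf₁ : w ≠ f₁ := by
    rintro rfl
    tauto
  have her₂ : e ≠ r₂ := by
    rintro rfl
    tauto
  have hef₁ : e ≠ f₁ := by
    rintro rfl
    tauto
  have hlast := heq ▸ h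
  have hex : D.Adj e x := by
    by_contra hn
    have h1 : D.Omits m x (f₀ :: ((r₀ :: f₁ :: r₁ :: f₂ :: r₂ :: (K ++ [w])) ++ [e])) := by
      simpa using hlast
    exact hf₀.2.1 ((h1.rule_last T).2 hn)
  have hxe := (hs e).2 hex
  have g1 : r₀ ∈ D.gaps f₃ :=
    ⟨m5, h.not_gap_adj T hx hf₃ n6 hr₀ (l₁ := []),
      h.not_adj_gap T hx hf₃ k4 ((hs _).1 hr₀) (l₁ := [f₀])⟩
  have g2 : r₁ ∈ D.gaps f₃ :=
    ⟨j3, h.not_gap_adj T hx hf₃ k4 hr₁ (l₁ := [f₀, r₀]),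
      h.not_adj_gap T hx hf₃ i2 ((hs _).1 hr₁) (l₁ := [f₀, r₀, f₁])⟩
  have g3 : r₂ ∈ D.gaps f₁ :=
    ⟨fun h => k3 h.symm, h.not_gap_adj T hx hf₁ (Ne.symm k2) hr₂ (l₁ := [f₀, r₀, f₁, r₁]),
      h.not_adj_gap T hx hf₁ (Ne.symm k4) ((hs _).1 hr₂) (l₁ := [f₀, r₀, f₁, r₁, f₂])⟩
  have hcyc : D.Omits m x ([] ++ e ::
      f₀ :: (r₀ :: f₁ :: r₁ :: f₂ :: r₂ :: (K ++ [w]))) := by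
    have h1 : D.Omits m x ((f₀ :: r₀ :: f₁ :: r₁ :: f₂ :: r₂ :: (K ++ [w])) ++ [e]) := by
      simpa using hlast
    exact h1.rotate
  have g4 : e ∈ D.gaps f₁ :=
    ⟨hef₁, hlast.not_gap_adj T hx hf₁ hwf₁ hxe, hcyc.not_adj_gap T hx hf₁ n2 hex⟩
  obtain ⟨l, hl⟩ := hx.1
  have hrr := (bad_of_gap T hl hf₃ g1 hr₀).complete T g1 g2 m2
  have her := (bad_of_gap T hl hf₁ g3 hr₂).complete T g4 g3 her₂
  obtain ⟨a, b, hseg, -⟩ := h.closed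
  obtain ⟨a', b', -, -, hseg'⟩ :=
    Seg.split (l := [f₀, r₀, f₁, r₁, f₂, r₂]) (l' := f₃ :: r₃ :: M) hseg (by simp) (by simp)
  have := hseg'.head_eq
  subst this
  have : e = b := Seg.last_eq (l := K ++ [w]) (by simpa [hK] using hseg')
  subst this
  have h12 : D.Adj r₁ f₂ := (h.rotate (l₁ := [f₀, r₀, f₁])).adj_of_cons
  have d1 := hx.complete T hf₂ hf₀ (Ne.symm n4)
  have d2 := hx.complete T hf₀ hf₁ n2
  have d3 := hx.complete T hf₁ hf₃ k4
  exact T.not_ham h.nodup h.length_eq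
    (((((((((hseg'.concat her).cons d3).cons d2).cons d1).cons h12).cons hrr).cons hr₀)))
    ((hs _).1 hr₂) (List.perm_iff_count.2 fun a => by
        simp only [List.count_append, List.count_cons, List.count_nil]; ring)

theorem Bad.exceptional (hx : D.Bad m x) (T : D.Tight m) :
    D.IsIsomorphic D5 ∨ D.IsIsomorphic D7 ∨ ∃ E ∈ L1, D.IsIsomorphic E := by
  obtain ⟨y, hy, hmax⟩ := Set.exists_max_image {y | D.Bad m y} (fun y => (D.gaps y).ncard)
    (Set.toFinite _) ⟨x, hx⟩
  have hy' : D.Bad m y := hy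
  have hs : ∀ v, D.Adj y v ↔ D.Adj v y := fun v =>
    Set.ext_iff.1 (hy'.symm_of_max T hmax) v
  obtain ⟨⟨l, hl⟩, f, hf, g, hg, hfg⟩ := hy'
  obtain ⟨t, ht⟩ := hl.exists_rotate (hl.mem T hf.1)
  have hlen := ht.length
  match t, ht, hlen with
  | [], _, hlen => simp at hlen; omega
  | [r], ht, hlen =>
    exfalso
    have hr : D.Adj y r := (ht.alternate T hs (l₁ := [])).2 hf.2.1
    have hgl := ht.mem T hg.1
    simp only [List.mem_cons, List.not_mem_nil, or_false] at hgl
    rcases hgl with rfl | rfl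
    · exact T.loopless _ hfg
    · exact hg.2.1 hr
  | [_, _], _, hlen => simp at hlen; omega
  | [_, _, _], ht, hlen =>
    obtain rfl : m = 2 := by simp at hlen; omega
    rcases hy.order_five T hs ht hf with h | h
    · exact Or.inl h
    · exact Or.inr (Or.inr h)
  | [_, _, _, _], _, hlen => simp at hlen; omega
  | [_, _, _, _, _], ht, hlen =>
    obtain rfl : m = 3 := by simp at hlen; omega
    exact Or.inr (Or.inl (hy.order_seven T hs ht hf))
  | [_, _, _, _, _, _], _, hlen => simp at hlen; omega
  | _ :: _ :: _ :: _ :: _ :: _ :: _ :: M, ht, _ =>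
    exact (hy.false_of_order_ge_nine T hs ht hf).elim

end

/-! ### No bad vertex: twins and the class `L₂` -/

section

variable {V : Type*} {D : Digraph V} {m : ℕ} {x : V} {l : List V}
  {c : ZMod (2 * m) → V}

theorem IsDirCycle.omits (hc : D.IsDirCycle c) (hm : 1 ≤ m) (hx : x ∉ Set.range c)
    (i : ZMod (2 * m)) : D.Omits m x (arc c (i + 1) (2 * m)) := by
  have : NeZero (2 * m) := ⟨by omega⟩
  refine ⟨List.nodup_cons.2 ⟨?_, hc.nodup_arc _ le_rfl⟩, length_arc _ _ _, _, _, hc.seg_full i,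
    hc.2.2 i⟩
  rwa [mem_arc_of_mem_range]

theorem IsDirCycle.shift (hc : D.IsDirCycle c) (a : ZMod (2 * m)) :
    D.IsDirCycle (fun i => c (a + i)) :=
  ⟨hc.1, fun _ _ h => add_left_cancel (hc.2.1 h), fun i => by
    have := hc.2.2 (a + i)
    rwa [add_assoc] at this⟩

variable [Finite V]

theorem mem_range_of_ne (hcard : Nat.card V = 2 * m + 1) (hc : Function.Injective c) (hm : 1 ≤ m)
    (hx : x ∉ Set.range c) {v : V} (hv : v ≠ x) : v ∈ Set.range c := by
  have : NeZero (2 * m) := ⟨by omega⟩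
  have h1 : (Set.range c).ncard = 2 * m := by
    rw [← Set.image_univ, Set.ncard_image_of_injective _ hc, Set.ncard_univ, Nat.card_zmod]
  have h2 : insert x (Set.range c) = Set.univ := by
    rw [Set.eq_univ_iff_ncard, Set.ncard_insert_of_notMem hx, h1, hcard]
  have h3 : v ∈ insert x (Set.range c) := h2 ▸ Set.mem_univ v
  exact h3.resolve_left hv

theorem tight_of_not_hasTCycle (hm : 1 ≤ m) (hcard : Nat.card V = 2 * m + 1) (hloop : D.Loopless)
    (h : ¬ D.HasTCycle m) : D.Tight m := by
  refine ⟨hm, hcard, hloop, ?_, ?_⟩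
  · intro c hc
    refine h ⟨_, c, hc, fun v _ _ => ?_⟩
    have hb : Function.Bijective c :=
      (Nat.bijective_iff_injective_and_card c).2 ⟨hc.2.1, by rw [Nat.card_zmod, hcard]⟩
    exact hb.2 v
  · intro c hc w hw
    by_contra hn
    refine h ⟨_, c, hc, fun v h1 h2 => mem_range_of_ne hcard hc.2.1 hm hw ?_⟩
    rintro rfl
    exact hn ⟨h1, h2⟩

theorem Omits.gaps_nonempty (h : D.Omits m x l) (T : D.Tight m) : (D.gaps x).Nonempty := by
  obtain ⟨hin, hout⟩ := h.deg T
  have hm := T.pos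
  obtain ⟨a, ha⟩ : (D.inNbhd x).Nonempty := by
    rw [← Set.ncard_pos (Set.toFinite _), ← inDeg]
    omega
  obtain ⟨b, hb⟩ : (D.outNbhd x).Nonempty := by
    rw [← Set.ncard_pos (Set.toFinite _), ← outDeg]
    omega
  change D.Adj a x at ha
  change D.Adj x b at hb
  have hane : a ≠ x := by rintro rfl; exact T.loopless _ ha
  have hbne : b ≠ x := by rintro rfl; exact T.loopless _ hb
  have hnot : ∃ d ∈ l, ¬ D.Adj d x := by
    obtain ⟨t, ht⟩ := h.exists_rotate (h.mem T hbne)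
    rcases List.eq_nil_or_concat t with rfl | ⟨t', d, rfl⟩
    · have := ht.length
      simp at this
      omega
    · rw [List.concat_eq_append] at ht
      have h1 := (ht.rule_last T).1 hb
      exact ⟨d, h.mem T (ht.ne_of_mem (by simp)), h1⟩
  obtain ⟨d, hd, hdx⟩ := hnot
  obtain ⟨u, w, t, hrot, hu, hw⟩ := exists_cyclic_switch (fun v => D.Adj v x) (h.mem T hane) hd
    ha hdx
  have ht := h.isRotated hrot
  exact ⟨w, ht.ne_of_mem (by simp), fun h => (ht.rule T).1 h hu, hw⟩

/-- The successor of an in-neighbour of `x` is not dominated by `x`, so unless it is the gap `c 0`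
it is again an in-neighbour. The `m` in-neighbours thus fill the end of the range `1, …, 2m - 1`,
and the rule gives the out-neighbours. -/
theorem adj_iff_of_unique_gap (T : D.Tight m) (hc : D.IsDirCycle c) (hx : x ∉ Set.range c)
    (hg : D.gaps x = {c 0}) {i : ℕ} (hi : 1 ≤ i) (hi' : i ≤ 2 * m - 1) :
    (D.Adj (c i) x ↔ m ≤ i) ∧ (D.Adj x (c i) ↔ i ≤ m) := by
  classical
  have hm := T.pos
  have : NeZero (2 * m) := ⟨by omega⟩
  obtain ⟨hrule, hin, -⟩ := T.cycle_rule hc hx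
  have h0 : c 0 ∈ D.gaps x := by rw [hg]; rfl
  have hinj : ∀ i j : ℕ, i < 2 * m → j < 2 * m → c i = c j → i = j := by
    intro i j hi hj hij
    have h := hc.2.1 hij
    rw [ZMod.natCast_eq_natCast_iff'] at h
    rwa [Nat.mod_eq_of_lt hi, Nat.mod_eq_of_lt hj] at h
  let S : Finset ℕ := (Finset.Icc 1 (2 * m - 1)).filter fun i => D.Adj (c i) x
  have hSin : D.inNbhd x = (fun i : ℕ => c i) '' (S : Set ℕ) := by
    ext v
    constructor
    · intro hv
      change D.Adj v x at hv
      obtain ⟨j, rfl⟩ := mem_range_of_ne T.card hc.2.1 hm hx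
        (show v ≠ x by rintro rfl; exact T.loopless _ hv)
      have hj0 : j ≠ 0 := by rintro rfl; exact h0.2.2 hv
      have hjv : j.val ≠ 0 := by rwa [Ne, ZMod.val_eq_zero]
      have hlt := ZMod.val_lt j
      refine ⟨j.val, ?_, by simp⟩
      simp only [S, Finset.coe_filter, Finset.mem_Icc, Set.mem_ofPred_eq, ZMod.natCast_zmod_val]
      exact ⟨⟨by omega, by omega⟩, hv⟩
    · rintro ⟨j, hj, rfl⟩
      simp only [S, Finset.coe_filter, Finset.mem_Icc, Set.mem_ofPred_eq] at hj
      exact hj.2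
  have hScard : S.card = m := by
    rw [← hin, inDeg, hSin, Set.InjOn.ncard_image, Set.ncard_coe_finset]
    intro i hi j hj hij
    simp only [S, Finset.coe_filter, Finset.mem_Icc, Set.mem_ofPred_eq] at hi hj
    exact hinj i j (by omega) (by omega) hij
  have hstep : ∀ i : ℕ, i + 1 ≤ 2 * m - 1 → D.Adj (c i) x → D.Adj (c ((i + 1 : ℕ))) x := by
    intro i hi hix
    by_contra hn
    have h1 : ¬ D.Adj x (c ((i + 1 : ℕ))) := by
      intro h2
      push_cast at h2
      exact (hrule i).1 h2 hix
    have h2 : c ((i + 1 : ℕ)) ∈ D.gaps x := ⟨fun h => hx ⟨_, h⟩, h1, hn⟩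
    rw [hg] at h2
    have := hinj (i + 1) 0 (by omega) (by omega) (by simpa using h2)
    omega
  have hmono : ∀ k i : ℕ, i + k ≤ 2 * m - 1 → D.Adj (c i) x → D.Adj (c ((i + k : ℕ))) x := by
    intro k
    induction k with
    | zero => simp
    | succ k ih => exact fun i hi hix => hstep (i + k) (by omega) (ih i (by omega) hix)
  have key : ∀ i : ℕ, 1 ≤ i → i ≤ 2 * m - 1 → (D.Adj (c i) x ↔ m ≤ i) := by
    intro i hi hi'
    constructor
    · intro hix
      have hsub : Finset.Icc i (2 * m - 1) ⊆ S := by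
        intro j hj
        rw [Finset.mem_Icc] at hj
        simp only [S, Finset.mem_filter, Finset.mem_Icc]
        refine ⟨⟨by omega, hj.2⟩, ?_⟩
        have := hmono (j - i) i (by omega) hix
        rwa [Nat.add_sub_cancel' hj.1] at this
      have := Finset.card_le_card hsub
      rw [Nat.card_Icc] at this
      omega
    · intro hmi
      by_contra hn
      have hsub : S ⊆ Finset.Icc (i + 1) (2 * m - 1) := by
        intro j hj
        simp only [S, Finset.mem_filter, Finset.mem_Icc] at hj
        rw [Finset.mem_Icc]
        refine ⟨?_, hj.1.2⟩
        by_contra hji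
        have := hmono (i - j) j (by omega) hj.2
        rw [Nat.add_sub_cancel' (by omega)] at this
        exact hn this
      have := Finset.card_le_card hsub
      rw [Nat.card_Icc] at this
      omega
  refine ⟨key i hi hi', ?_⟩
  have h1 := hrule ((i - 1 : ℕ) : ZMod (2 * m))
  have e : ((i - 1 : ℕ) : ZMod (2 * m)) + 1 = (i : ZMod (2 * m)) := by
    rw [Nat.cast_sub hi]
    simp
  rw [e] at h1
  rw [h1]
  rcases Nat.eq_or_lt_of_le hi with rfl | hlt
  · simp only [Nat.sub_self, Nat.cast_zero]
    exact ⟨fun _ => hm, fun _ => h0.2.2⟩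
  · rw [key (i - 1) (by omega) (by omega)]
    omega

theorem IsDirCycle.update_gap (T : D.Tight m) (hc : D.IsDirCycle c) (hx : x ∉ Set.range c)
    (h0 : c 0 ∈ D.gaps x) :
    D.IsDirCycle (Function.update c 0 x) ∧ c 0 ∉ Set.range (Function.update c 0 x) := by
  have hm := T.pos
  have h10 : (1 : ZMod (2 * m)) ≠ 0 := by
    have : Fact (1 < 2 * m) := ⟨by omega⟩
    exact one_ne_zero
  obtain ⟨hrule, -⟩ := T.cycle_rule hc hx
  have hval : ∀ i, i ≠ 0 → Function.update c 0 x i = c i := fun i hi =>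
    Function.update_of_ne hi _ _
  have hz : Function.update c 0 x 0 = x := Function.update_self _ _ _
  refine ⟨⟨hc.1, ?_, ?_⟩, ?_⟩
  · intro i j hij
    by_cases hi : i = 0 <;> by_cases hj : j = 0
    · rw [hi, hj]
    · rw [hi, hz, hval j hj] at hij
      exact absurd ⟨j, hij.symm⟩ hx
    · rw [hj, hz, hval i hi] at hij
      exact absurd ⟨i, hij⟩ hx
    · rw [hval i hi, hval j hj] at hij
      exact hc.2.1 hij
  · intro i
    by_cases hi : i = 0
    · subst hi
      rw [zero_add, hz, hval 1 h10]
      have := (hrule 0).2 h0.2.2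
      rwa [zero_add] at this
    · rw [hval i hi]
      by_cases hi1 : i + 1 = 0
      · rw [hi1, hz]
        by_contra hn
        have := (hrule i).2 hn
        rw [hi1] at this
        exact h0.2.1 this
      · rw [hval _ hi1]
        exact hc.2.2 i
  · rintro ⟨i, hi⟩
    by_cases hi0 : i = 0
    · rw [hi0, hz] at hi
      exact h0.1 hi.symm
    · rw [hval i hi0] at hi
      exact hi0 (hc.2.1 hi)

theorem exists_index (hcard : Nat.card V = 2 * m + 1) (hm : 1 ≤ m) (hc : Function.Injective c)
    (hx : x ∉ Set.range c) {v : V} (hv : v ≠ x) (hv0 : v ≠ c 0) :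
    ∃ i : ℕ, 1 ≤ i ∧ i ≤ 2 * m - 1 ∧ v = c i := by
  have : NeZero (2 * m) := ⟨by omega⟩
  obtain ⟨j, rfl⟩ := mem_range_of_ne hcard hc hm hx hv
  have hj0 : j ≠ 0 := by rintro rfl; exact hv0 rfl
  have hjv : j.val ≠ 0 := by rwa [Ne, ZMod.val_eq_zero]
  have hlt := ZMod.val_lt j
  exact ⟨j.val, by omega, by omega, by simp⟩

/-- A second gap of `x`, or of `c 0`, reduces this to `Omits.gap_twins`. If each is the only gap of
the other, both neighbourhoods are given by the same index intervals, on `c` and on the cycle with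
`x` in place of `c 0`. -/
theorem twins_of_no_bad (T : D.Tight m) (hbad : ∀ y, ¬ D.Bad m y) (hc : D.IsDirCycle c)
    (hx : x ∉ Set.range c) (h0 : c 0 ∈ D.gaps x) :
    D.outNbhd x = D.outNbhd (c 0) ∧ D.inNbhd x = D.inNbhd (c 0) := by
  have hm := T.pos
  have : NeZero (2 * m) := ⟨by omega⟩
  have hl := hc.omits hm hx 0
  have hnon : ∀ {y l}, D.Omits m y l → ∀ g ∈ D.gaps y, ∀ h ∈ D.gaps y, D.NonAdjacent g h := by
    intro y l hl g hg h hh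
    exact ⟨fun hn => hbad y ⟨⟨l, hl⟩, g, hg, h, hh, hn⟩,
      fun hn => hbad y ⟨⟨l, hl⟩, h, hh, g, hg, hn⟩⟩
  by_cases h1 : ∃ g ∈ D.gaps x, g ≠ c 0
  · obtain ⟨g, hg, hne⟩ := h1
    exact hl.gap_twins T h0 hg hne.symm (hnon hl _ h0 _ hg)
  obtain ⟨l', hl'⟩ := hl.exists_omits_gap T h0
  have hx' := gaps_symm h0
  by_cases h2 : ∃ g ∈ D.gaps (c 0), g ≠ x
  · obtain ⟨g, hg, hne⟩ := h2
    have := hl'.gap_twins T hx' hg hne.symm (hnon hl' _ hx' _ hg)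
    exact ⟨this.1.symm, this.2.symm⟩
  push Not at h1 h2
  obtain ⟨hc', hx''⟩ := hc.update_gap T hx h0
  have hg1 : D.gaps x = {c 0} := Set.eq_singleton_iff_unique_mem.2 ⟨h0, h1⟩
  have hg2 : D.gaps (c 0) = {Function.update c 0 x 0} := by
    rw [Function.update_self]
    exact Set.eq_singleton_iff_unique_mem.2 ⟨hx', h2⟩
  have key : ∀ v, (D.Adj x v ↔ D.Adj (c 0) v) ∧ (D.Adj v x ↔ D.Adj v (c 0)) := by
    intro v
    by_cases hvx : v = x
    · subst hvx
      simp [T.loopless v, h0.2.1, h0.2.2]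
    by_cases hv0 : v = c 0
    · rw [hv0]
      simp [T.loopless (c 0), h0.2.1, h0.2.2]
    obtain ⟨i, hi, hi', rfl⟩ := exists_index T.card hm hc.2.1 hx hvx hv0
    have hi0 : (i : ZMod (2 * m)) ≠ 0 := by
      intro h
      exact hv0 (by rw [h])
    have e1 := adj_iff_of_unique_gap T hc hx hg1 hi hi'
    have e2 := adj_iff_of_unique_gap T hc' hx'' hg2 hi hi'
    rw [Function.update_of_ne hi0] at e2
    exact ⟨e1.2.trans e2.2.symm, e1.1.trans e2.1.symm⟩
  exact ⟨Set.ext fun v => (key v).1, Set.ext fun v => (key v).2⟩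

theorem memL2_of_unique_gap (T : D.Tight m) (hc : D.IsDirCycle c) (hx : x ∉ Set.range c)
    (hg : D.gaps x = {c 0}) (hout : D.outNbhd x = D.outNbhd (c 0))
    (hin : D.inNbhd x = D.inNbhd (c 0)) : D.MemL2 m := by
  classical
  have hm := T.pos
  have : NeZero (2 * m) := ⟨by omega⟩
  have h0 : c 0 ∈ D.gaps x := by rw [hg]; rfl
  have e0 : c ((2 * m : ℕ) : ZMod (2 * m)) = c 0 := by rw [ZMod.natCast_self]
  have hadj := fun (i : ℕ) (hi : 1 ≤ i) (hi' : i ≤ 2 * m - 1) =>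
    adj_iff_of_unique_gap T hc hx hg hi hi'
  refine ⟨c, x, hc, hx, ?_, e0 ▸ h0.2, ?_, e0 ▸ hout.symm, ?_, e0 ▸ hin.symm, ?_⟩
  · intro v
    by_cases hv : v = x
    · exact Or.inl hv
    · exact Or.inr (mem_range_of_ne T.card hc.2.1 hm hx hv)
  · ext v
    constructor
    · intro hv
      change D.Adj x v at hv
      obtain ⟨i, hi, hi', rfl⟩ := exists_index (v := v) T.card hm hc.2.1 hx
        (by rintro rfl; exact T.loopless _ hv) (by rintro rfl; exact h0.2.1 hv)
      exact ⟨i, hi, (hadj i hi hi').2.1 hv, rfl⟩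
    · rintro ⟨i, hi, hi', rfl⟩
      exact (hadj i hi (by omega)).2.2 hi'
  · ext v
    constructor
    · intro hv
      change D.Adj v x at hv
      obtain ⟨i, hi, hi', rfl⟩ := exists_index (v := v) T.card hm hc.2.1 hx
        (by rintro rfl; exact T.loopless _ hv) (by rintro rfl; exact h0.2.2 hv)
      exact ⟨i, (hadj i hi hi').1.1 hv, hi', rfl⟩
    · rintro ⟨i, hi, hi', rfl⟩
      exact (hadj i (by omega) hi').1.2 hi
  -- An arc from `c i` to `c j` gives the Hamiltonian cycle `c 1 … c i c j … c (2m - 1) x c (i + 1)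
  -- … c (j - 1) c 0`: here `i + 1 ≤ m` gives `x → c (i + 1)`, and `m ≤ j - 1` gives `c (j - 1) → c
  -- 0`, as `c 0` is a twin of `x`. The substitutions make the three stretches visibly non-empty.
  · intro i j hi hi' hj hj' hij
    obtain ⟨i', rfl⟩ : ∃ i', i = i' + 1 := ⟨i - 1, by omega⟩
    obtain ⟨k, rfl⟩ : ∃ k, j = (i' + 1) + (k + 1) + 1 := ⟨j - i' - 3, by omega⟩
    obtain ⟨r, hr⟩ : ∃ r, 2 * m = (i' + 1) + (k + 1) + 1 + (r + 1) :=
      ⟨2 * m - (i' + k + 4), by omega⟩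
    have s1 := hc.seg_arc 1 i'
    have s2 := hc.seg_arc ((i' + 1 : ℕ) + 1) k
    have s3 := hc.seg_arc (((i' + 1 + (k + 1) + 1 : ℕ) : ZMod (2 * m))) r
    have hL : arc c 0 (2 * m) = [c 0] ++ arc c 1 (i' + 1) ++
        arc c ((i' + 1 : ℕ) + 1) (k + 1) ++
        arc c (((i' + 1 + (k + 1) + 1 : ℕ) : ZMod (2 * m))) (r + 1) := by
      have e : (2 * m) = 1 + (i' + 1) + (k + 1) + (r + 1) := by omega
      have : arc c 0 (2 * m) = arc c 0 (1 + (i' + 1) + (k + 1) + (r + 1)) := by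
        rw [← e]
      rw [this, arc_add, arc_add, arc_add, arc_one]
      congr 3
      · simp
      · push_cast
        ring
      · push_cast
        ring
    have t1 : (1 : ZMod (2 * m)) + (i' : ZMod (2 * m)) = ((i' + 1 : ℕ) : ZMod (2 * m)) := by
      push_cast
      ring
    have t2 : ((i' + 1 : ℕ) + 1 : ZMod (2 * m)) + (k : ZMod (2 * m)) =
        ((i' + 1 + (k + 1) : ℕ) : ZMod (2 * m)) := by
      push_cast
      ring
    have t3 : ((i' + 1 + (k + 1) + 1 : ℕ) : ZMod (2 * m)) + (r : ZMod (2 * m)) =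
        ((2 * m - 1 : ℕ) : ZMod (2 * m)) := by
      have : 2 * m - 1 = i' + 1 + (k + 1) + 1 + r := by omega
      rw [this]
      push_cast
      ring
    have t4 : ((i' + 1 : ℕ) + 1 : ZMod (2 * m)) = ((i' + 2 : ℕ) : ZMod (2 * m)) := by
      push_cast
      ring
    rw [t1] at s1
    rw [t2] at s2
    rw [t3] at s3
    have a1 : D.Adj (c ((2 * m - 1 : ℕ))) x := (hadj _ (by omega) le_rfl).1.2 (by omega)
    have a2 : D.Adj x (c ((i' + 1 : ℕ) + 1)) := by
      rw [t4]
      exact (hadj _ (by omega) (by omega)).2.2 (by omega)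
    have a3 : D.Adj (c ((i' + 1 + (k + 1) : ℕ))) (c 0) := by
      have h1 : c ((i' + 1 + (k + 1) : ℕ)) ∈ D.inNbhd x :=
        (hadj _ (by omega) (by omega)).1.2 (by omega)
      rw [hin] at h1
      exact h1
    have a4 : D.Adj (c 0) (c 1) := by
      have := hc.2.2 0
      rwa [zero_add] at this
    have ho := hc.omits hm hx (-1)
    rw [neg_add_cancel] at ho
    have hnd := ho.nodup
    have hlen := ho.length_eq
    rw [hL] at hnd hlen
    exact T.not_ham hnd hlen ((((s1.append hij s3).concat a1).append a2 s2).concat a3) a4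
      (List.perm_iff_count.2 fun a => by
        simp only [List.count_append, List.count_cons, List.count_nil]; ring)

end

end Digraph

/-! ### The case distinction -/

theorem theorem2 {V : Type*} [Fintype V] (D : Digraph V) (m : ℕ) (hm : 3 ≤ 2 * m + 1)
    (hcard : Fintype.card V = 2 * m + 1) (hloop : D.Loopless) (hstrong : D.IsStrong)
    (hcycle : ∃ c : ZMod (2 * m) → V, D.IsDirCycle c) :
    D.HasTCycle m ∨
    (D.IsIsomorphic Digraph.D5 ∨ D.IsIsomorphic Digraph.D7 ∨
      (∃ E ∈ Digraph.L1, D.IsIsomorphic E) ∨ D.MemL2 m) ∨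
    D.IsBetween m ∨
    D.HasTwinStructure m := by
  by_cases hT : D.HasTCycle m
  · exact Or.inl hT
  right
  have hm1 : 1 ≤ m := by omega
  have hne : NeZero (2 * m) := ⟨by omega⟩
  rw [← Nat.card_eq_fintype_card] at hcard
  have T := Digraph.tight_of_not_hasTCycle hm1 hcard hloop hT
  by_cases hbad : ∃ y, D.Bad m y
  · obtain ⟨y, hy⟩ := hbad
    left
    rcases hy.exceptional T with h | h | h
    · exact Or.inl h
    · exact Or.inr (Or.inl h)
    · exact Or.inr (Or.inr (Or.inl h))
  push Not at hbad
  obtain ⟨c, hc⟩ := hcycle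
  obtain ⟨x, hx⟩ : ∃ x, x ∉ Set.range c := by
    by_contra h
    push Not at h
    have hb : Function.Bijective c := ⟨hc.2.1, h⟩
    have := Nat.card_eq_of_bijective c hb
    rw [Nat.card_zmod, hcard] at this
    omega
  have hl := hc.omits hm1 hx 0
  have hshift : ∀ a : ZMod (2 * m), x ∉ Set.range fun i => c (a + i) := by
    rintro a ⟨i, hi⟩
    exact hx ⟨_, hi⟩
  have htw : ∀ a, c a ∈ D.gaps x →
      D.outNbhd x = D.outNbhd (c a) ∧ D.inNbhd x = D.inNbhd (c a) := by
    intro a ha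
    have := Digraph.twins_of_no_bad T hbad (hc.shift a) (hshift a) (by simpa using ha)
    simpa using this
  have hgap : ∀ i, D.NonAdjacent x (c i) ↔ c i ∈ D.gaps x := fun i =>
    ⟨fun h => ⟨fun h' => hx ⟨i, h'⟩, h⟩, fun h => h.2⟩
  have himg : D.gaps x = c '' {i | D.NonAdjacent x (c i)} := by
    ext v
    constructor
    · intro hv
      obtain ⟨i, rfl⟩ := Digraph.mem_range_of_ne hcard hc.2.1 hm1 hx hv.1
      exact ⟨i, hv.2, rfl⟩
    · rintro ⟨i, hi, rfl⟩
      exact (hgap i).1 hi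
  by_cases h2 : 2 ≤ {i | D.NonAdjacent x (c i)}.ncard
  · right
    right
    obtain ⟨hrule, -⟩ := T.cycle_rule hc hx
    refine ⟨c, x, hc, hx, h2, ?_, ?_⟩
    · intro i hi
      obtain ⟨h3, h4⟩ := htw i ((hgap i).1 hi)
      refine ⟨?_, (hrule i).2 hi.2, h3, h4⟩
      by_contra hn
      have := (hrule (i - 1)).2 hn
      rw [sub_add_cancel] at this
      exact hi.1 this
    -- Every member has the out-neighbourhood of `x`, which contains no member; this is
    -- independence.
    · have hall : ∀ v ∈ insert x {v | ∃ i, v = c i ∧ D.NonAdjacent x (c i)},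
          D.outNbhd x = D.outNbhd v ∧ D.NonAdjacent x v := by
        rintro v (rfl | ⟨i, rfl, hi⟩)
        · exact ⟨rfl, hloop v, hloop v⟩
        · exact ⟨(htw i ((hgap i).1 hi)).1, hi⟩
      intro u hu v hv _
      obtain ⟨hu1, hu2⟩ := hall u hu
      obtain ⟨hv1, hv2⟩ := hall v hv
      constructor
      · intro h
        have h3 : v ∈ D.outNbhd x := hu1 ▸ h
        exact hv2.1 h3
      · intro h
        have h3 : u ∈ D.outNbhd x := hv1 ▸ h
        exact hu2.1 h3
  · left
    right
    right
    right
    have hpos : 0 < (D.gaps x).ncard :=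
      (Set.ncard_pos (Set.toFinite _)).2 (hl.gaps_nonempty T)
    have hle : (D.gaps x).ncard = {i | D.NonAdjacent x (c i)}.ncard := by
      rw [himg, Set.ncard_image_of_injective _ hc.2.1]
    obtain ⟨f, hf⟩ := Set.ncard_eq_one.1 (show (D.gaps x).ncard = 1 by omega)
    have hfm : f ∈ D.gaps x := by rw [hf]; rfl
    obtain ⟨a, rfl⟩ := Digraph.mem_range_of_ne hcard hc.2.1 hm1 hx hfm.1
    obtain ⟨h3, h4⟩ := htw a hfm
    exact Digraph.memL2_of_unique_gap T (hc.shift a) (hshift a) (by simpa using hf)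
      (by simpa using h3) (by simpa using h4)
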